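/- Let $G$ be a (discrete) group and let $L^2(G)$ be the Hilbert space of square-summable formal sums $\sum_{g\in G}\lambda_g\, g$, $\lambda_g\in\mathbb{C}$. An $(r,s)$-matrix $A=(a_{k,j})$ over $\mathbb{Z}G$ defines a bounded $G$-equivariant operator $r_A^{(2)}\colon L^2(G)^r\to L^2(G)^s$, $(x_k)_k\mapsto\bigl(\sum_{k} x_k a_{k,j}\bigr)_j$. For a bounded $G$-equivariant operator $f\colon L^2(G)^r\to L^2(G)^s$ let $F_f(\lambda)=\dim_{\mathcal{N}(G)}\bigl(\operatorname{im} E^{f^*f}_{\lambda^2}\bigr)$ for $\lambda\ge 0$ and $F_f(\lambda)=0$ for $\lambda<0$ be its spectral density function, where $(E^{f^*f}_{\mu})_{\mu}$ is the right-continuous family of spectral projections of $f^*f$ and $\dim_{\mathcal{N}(G)}(V)=\sum_{i=1}^r\langle p_V(e_i),e_i\rangle$ for a closed $G$-invariant subspace $V\subseteq L^2(G)^r$ with orthogonal projection $p_V$, and $e_i\in L^2(G)^r$ has the unit element of $G$ as its $i$-th entry and $0$ elsewhere. The Fuglede--Kadison determinant is $\det_{\mathcal{N}(G)}(f)=\exp\bigl(\int_{0+}^{\infty}\ln(\lambda)\,dF_f(\lambda)\bigr)$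 if the integral converges to a real number, and $0$ otherwise. A bounded $G$-equivariant operator is a weak isomorphism if it is injective with dense image. Let $\Lambda(G)$ be the infimum of all values $\det_{\mathcal{N}(G)}(r_A^{(2)})>1$, where $A$ runs through the $(r,s)$-matrices over $\mathbb{Z}G$ for all $r,s\ge1$. Let $\Lambda_1(G)$ be the infimum of these values if only $(1,1)$-matrices are allowed, $\Lambda^w(G)$ if only $(r,r)$-matrices, $r\ge 1$, for which $r_A^{(2)}$ is a weak isomorphism are allowed, and $\Lambda_1^w(G)$ if only $(1,1)$-matrices for which $r_A^{(2)}$ is a weak isomorphism are allowed. Then the following holds. 1. If $H$ is a subgroup of $G$, then $\Lambda(G)\le\Lambda(H)$, $\Lambda_1(G)\le\Lambda_1(H)$, $\Lambda^w(G)\le\Lambda^w(H)$ and $\Lambda_1^w(G)\le\Lambda_1^w(H)$. 2. If $H\subseteq G$ is a subgroup of finite index, then $\Lambda(H)^{1/[G:H]}\le\Lambda(G)$ and $\Lambda^w(H)^{1/[G:H]}\le\Lambda^w(G)$. 3. $\Lambda_1(\{1\})=\Lambda^w(\{1\})=\Lambda_1^w(\{1\})=2$ and $\Lambda(\{1\})=\sqrt2$;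 moreover $\Lambda^w(\mathbb{Z}/2)=\Lambda_1^w(\mathbb{Z}/2)=\sqrt3$, $\Lambda_1(\mathbb{Z}/2)=\sqrt2$ and $2^{1/4}\le\Lambda(\mathbb{Z}/2)\le\sqrt2$. 4. If $G$ is finite and $|G|\ge3$, then $$2^{1/|G|}\le\Lambda^w(G)\le\Lambda_1^w(G)\le(|G|-1)^{1/|G|},\qquad 2^{1/(2|G|)}\le\Lambda(G)\le\Lambda_1(G)\le(|G|-1)^{1/|G|}.$$ 5. For every group $G$, $$\Lambda(G)=\inf_H\Lambda(H),\quad \Lambda_1(G)=\inf_H\Lambda_1(H),\quad \Lambda^w(G)=\inf_H\Lambda^w(H),\quad \Lambda_1^w(G)=\inf_H\Lambda_1^w(H),$$ where $H$ runs through the finitely generated subgroups of $G$. -/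

import Mathlib

open MeasureTheory Filter Topology
open scoped ENNReal InnerProductSpace

universe u

noncomputable section

namespace Lehmer

/-! ### The Hilbert spaces `L²(G)` and `L²(G)^r` -/

/-- `L²(G)`: square summable functions `G → ℂ`; `x` stands for the formal sum `∑ x(g) · g`. -/
abbrev L2 (G : Type u) : Type u := lp (fun _ : G => ℂ) 2

/-- `L²(G)^r`, the Hilbert space direct sum of `r` copies of `L²(G)`. -/
abbrev L2Pow (G : Type u) (r : ℕ) : Type u := PiLp 2 (fun _ : Fin r => L2 G)

variable {G : Type u} [Group G]

/-! ### Right multiplication with matrices over the integral group ring -/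

lemma memℓp_translate (g : G) (x : L2 G) : Memℓp (fun h : G => x (h * g⁻¹)) 2 := by
  have hx := (lp.memℓp x).summable (by norm_num)
  exact memℓp_gen ((Equiv.mulRight g⁻¹).summable_iff.mpr hx)

/-- Right multiplication `x ↦ x · g` on `L²(G)`. As `(∑ x(k) · k) · g = ∑ x(k) · kg`, the
coefficient of `x · g` at `h` is `x(h g⁻¹)`. -/
def rightTranslate (g : G) : L2 G →ₗᵢ[ℂ] L2 G where
  toFun x := ⟨fun h => x (h * g⁻¹), memℓp_translate g x⟩
  map_add' x y := by ext h; rfl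
  map_smul' c x := by ext h; rfl
  norm_map' x := by
    have h2 : 0 < (2 : ℝ≥0∞).toReal := by norm_num
    rw [lp.norm_eq_tsum_rpow h2, lp.norm_eq_tsum_rpow h2]
    congr 1
    exact (Equiv.mulRight g⁻¹).tsum_eq (fun h => ‖x h‖ ^ (2 : ℝ≥0∞).toReal)

/-- Right multiplication `x ↦ x · a` on `L²(G)` with `a = ∑ n_g · g` in `ℤG`. -/
def rightMul (a : MonoidAlgebra ℤ G) : L2 G →L[ℂ] L2 G :=
  a.coeff.sum fun g n => (n : ℂ) • (rightTranslate g).toContinuousLinearMap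

/-- The operator `r_A^{(2)} : L²(G)^r → L²(G)^s`,
`(x_k)_k ↦ (∑_k x_k · a_{k,j})_j`, of an `(r,s)`-matrix `A` over `ℤG`. -/
def rightMulMatrix {r s : ℕ} (A : Matrix (Fin r) (Fin s) (MonoidAlgebra ℤ G)) :
    L2Pow G r →L[ℂ] L2Pow G s :=
  (PiLp.continuousLinearEquiv 2 ℂ (fun _ : Fin s => L2 G)).symm.toContinuousLinearMap ∘L
    ContinuousLinearMap.pi fun j =>
      ∑ k, rightMul (A k j) ∘L PiLp.proj 2 (fun _ : Fin r => L2 G) k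

/-- A weak isomorphism: an injective bounded operator with dense image. -/
def IsWeakIso {r s : ℕ} (f : L2Pow G r →L[ℂ] L2Pow G s) : Prop :=
  Function.Injective f ∧ DenseRange f

/-! ### Von Neumann trace and dimension -/

/-- The vector of `L²(G)^r` with the unit element `e ∈ G ⊆ L²(G)` in position `i`, and `0`
elsewhere. -/
def unitVec (G : Type u) [Group G] (r : ℕ) (i : Fin r) : L2Pow G r :=
  open scoped Classical in PiLp.single 2 i (lp.single 2 (1 : G) (1 : ℂ))

/-- The von Neumann trace of an operator on `L²(G)^r`, i.e. the sum over the diagonal entries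
`a_{i,i}` of its matrix of `⟨a_{i,i}(e), e⟩`. (Mathlib's inner product is conjugate linear in the
first variable.) -/
def vnTrace {r : ℕ} (f : L2Pow G r →L[ℂ] L2Pow G r) : ℂ :=
  ∑ i, ⟪unitVec G r i, f (unitVec G r i)⟫_ℂ

/-- The von Neumann dimension of a closed (`G`-invariant) subspace of `L²(G)^r`: the von Neumann
trace of the orthogonal projection onto it. This trace is a nonnegative real number. -/
def vnDim {r : ℕ} (V : Submodule ℂ (L2Pow G r)) [V.HasOrthogonalProjection] : ℝ :=
  (vnTrace V.starProjection).re

/-! ### Spectral projections -/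

section Spectral

variable {E : Type*} [NormedAddCommGroup E] [InnerProductSpace ℂ E] [CompleteSpace E]

/-- The image of the spectral projection `E_μ^T` (the projection belonging to `(-∞, μ]`) of a
bounded selfadjoint operator `T`: the kernel of the positive part `(T - μ)₊`. -/
def spectralSubspace (T : E →L[ℂ] E) (μ : ℝ) : Submodule ℂ E :=
  (cfc (fun t : ℝ => max (t - μ) 0) T).ker

instance (T : E →L[ℂ] E) (μ : ℝ) : (spectralSubspace T μ).HasOrthogonalProjection :=
  inferInstanceAs (cfc (fun t : ℝ => max (t - μ) 0) T).ker.HasOrthogonalProjection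

lemma spectralSubspace_mono (T : E →L[ℂ] E) : Monotone (spectralSubspace T) := by
  intro μ ν h
  rcases h.eq_or_lt with rfl | hlt
  · exact le_rfl
  have hne : ∀ t : ℝ, max (t - μ) (ν - μ) ≠ 0 := fun t =>
    (lt_of_lt_of_le (sub_pos.2 hlt) (le_max_right _ _)).ne'
  have hc : Continuous fun t : ℝ => max (t - ν) 0 / max (t - μ) (ν - μ) := by
    refine Continuous.div (by fun_prop) (by fun_prop) hne
  have key : cfc (fun t : ℝ => max (t - ν) 0) T =
      cfc (fun t : ℝ => max (t - ν) 0 / max (t - μ) (ν - μ)) T *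
        cfc (fun t : ℝ => max (t - μ) 0) T := by
    rw [← cfc_mul _ _ T hc.continuousOn (by fun_prop)]
    congr 1
    funext t
    rcases le_total t ν with ht | ht
    · simp [max_eq_right (sub_nonpos.2 ht)]
    · have h1 : max (t - μ) (ν - μ) = t - μ := max_eq_left (by linarith)
      have h2 : max (t - μ) 0 = t - μ := max_eq_left (by linarith)
      have h3 : t - μ ≠ 0 := by linarith
      rw [h1, h2, div_mul_cancel₀ _ h3]
  intro v hv
  have hv' : cfc (fun t : ℝ => max (t - μ) 0) T v = 0 := hv
  change cfc (fun t : ℝ => max (t - ν) 0) T v = 0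
  rw [key, mul_apply_eq_comp, hv', map_zero]

lemma iInf_spectralSubspace (T : E →L[ℂ] E) (μ : ℝ) :
    ⨅ ν : Set.Ioi μ, spectralSubspace T ν = spectralSubspace T μ := by
  refine le_antisymm (fun v hv => ?_) (le_iInf fun ν => spectralSubspace_mono T ν.2.le)
  rw [Submodule.mem_iInf] at hv
  change cfc (fun t : ℝ => max (t - μ) 0) T v = 0
  rw [← norm_le_zero_iff]
  refine le_of_forall_pos_le_add fun ε hε => ?_
  have hd : 0 < ε / (‖v‖ + 1) := by positivity
  set ν := μ + ε / (‖v‖ + 1) with hν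
  have h0 : cfc (fun t : ℝ => max (t - ν) 0) T v = 0 := hv ⟨ν, by simp [hν, hd]⟩
  have hb : ‖cfc (fun t : ℝ => max (t - μ) 0) T - cfc (fun t : ℝ => max (t - ν) 0) T‖ ≤
      ε / (‖v‖ + 1) := by
    rw [← cfc_sub _ _ T (by fun_prop) (by fun_prop)]
    refine norm_cfc_le hd.le fun t _ => ?_
    refine (abs_max_sub_max_le_abs _ _ _).trans ?_
    rw [show t - μ - (t - ν) = ε / (‖v‖ + 1) by rw [hν]; ring, abs_of_pos hd]
  have h1 : cfc (fun t : ℝ => max (t - μ) 0) T v =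
      (cfc (fun t : ℝ => max (t - μ) 0) T - cfc (fun t : ℝ => max (t - ν) 0) T) v := by
    rw [sub_apply, h0, sub_zero]
  rw [h1, zero_add]
  calc _ ≤ ε / (‖v‖ + 1) * ‖v‖ := ContinuousLinearMap.le_of_opNorm_le _ hb v
    _ ≤ ε / (‖v‖ + 1) * (‖v‖ + 1) := by gcongr; linarith
    _ = ε := by field_simp

lemma tendsto_spectralProjection (T : E →L[ℂ] E) (μ : ℝ) (v : E) :
    Tendsto (fun ν => (spectralSubspace T ν).starProjection v) (𝓝[≥] μ)
      (𝓝 ((spectralSubspace T μ).starProjection v)) := by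
  suffices h : Tendsto (fun ν => (spectralSubspace T ν).starProjection v) (𝓝[>] μ)
      (𝓝 ((spectralSubspace T μ).starProjection v)) from
    continuousWithinAt_Ioi_iff_Ici.1 h
  have hm : Monotone fun ν : (Set.Ioi μ)ᵒᵈ => (spectralSubspace T ((OrderDual.ofDual ν : Set.Ioi μ) : ℝ))ᗮ :=
    fun a b hab => Submodule.orthogonal_le (spectralSubspace_mono T hab)
  have hU := Submodule.starProjection_tendsto_closure_iSup _ hm v
  have hcl : (⨆ ν : (Set.Ioi μ)ᵒᵈ,
      (spectralSubspace T ((OrderDual.ofDual ν : Set.Ioi μ) : ℝ))ᗮ).topologicalClosure =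
        (spectralSubspace T μ)ᗮ := by
    rw [← Submodule.orthogonal_orthogonal_eq_closure, ← Submodule.iInf_orthogonal]
    simp_rw [Submodule.orthogonal_orthogonal]
    rw [← iInf_spectralSubspace T μ]
    rfl
  simp_rw [hcl, Submodule.starProjection_orthogonal_val] at hU
  have hU2 := hU.const_sub v
  simp only [sub_sub_cancel] at hU2
  rw [← map_coe_Ioi_atBot μ, tendsto_map'_iff]
  exact hU2

end Spectral

lemma re_inner_starProjection {E : Type*} [NormedAddCommGroup E] [InnerProductSpace ℂ E]
    (V : Submodule ℂ E) [V.HasOrthogonalProjection] (v : E) :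
    (⟪v, V.starProjection v⟫_ℂ).re = ‖V.starProjection v‖ ^ 2 := by
  have h : (⟪V.starProjection v, v⟫_ℂ).re = ‖V.orthogonalProjectionOnto v‖ ^ 2 :=
    V.re_inner_starProjection_eq_normSq v
  rw [← inner_conj_symm, Complex.conj_re, h]
  rfl

/-! ### The Fuglede-Kadison determinant -/

/-- The spectral density function of `f : L²(G)^r → L²(G)^s`: it sends `t ≥ 0` to the von Neumann
dimension of the image of the spectral projection `E_{t²}^{f*f}`; it is extended by `0` to
`t < 0`. -/
def spectralDensity {r s : ℕ} (f : L2Pow G r →L[ℂ] L2Pow G s) (t : ℝ) : ℝ :=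
  if 0 ≤ t then vnDim (spectralSubspace (f.adjoint ∘L f) (t ^ 2)) else 0

lemma vnDim_eq {r : ℕ} (V : Submodule ℂ (L2Pow G r)) [V.HasOrthogonalProjection] :
    vnDim V = ∑ i, ‖V.starProjection (unitVec G r i)‖ ^ 2 := by
  simp only [vnDim, vnTrace, Complex.re_sum]
  refine Finset.sum_congr rfl fun i _ => ?_
  exact re_inner_starProjection V (unitVec G r i)

lemma vnDim_nonneg {r : ℕ} (V : Submodule ℂ (L2Pow G r)) [V.HasOrthogonalProjection] :
    0 ≤ vnDim V := by
  rw [vnDim_eq]; positivity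

lemma vnDim_mono {r : ℕ} {V W : Submodule ℂ (L2Pow G r)} [V.HasOrthogonalProjection]
    [W.HasOrthogonalProjection] (h : V ≤ W) : vnDim V ≤ vnDim W := by
  rw [vnDim_eq, vnDim_eq]
  refine Finset.sum_le_sum fun i _ => ?_
  gcongr
  have : V.starProjection (unitVec G r i) =
      V.starProjection (W.starProjection (unitVec G r i)) := by
    rw [Submodule.starProjection_apply, Submodule.starProjection_apply,
      Submodule.orthogonalProjectionOnto_starProjection_of_le h]
  rw [this]
  exact V.norm_starProjection_apply_le _

lemma spectralDensity_mono {r s : ℕ} (f : L2Pow G r →L[ℂ] L2Pow G s) :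
    Monotone (spectralDensity f) := by
  intro a b hab
  unfold spectralDensity
  split_ifs with ha hb hb
  · exact vnDim_mono (spectralSubspace_mono _ (by gcongr))
  · exact absurd (ha.trans hab) hb
  · exact vnDim_nonneg _
  · exact le_rfl

lemma spectralDensity_rightCont {r s : ℕ} (f : L2Pow G r →L[ℂ] L2Pow G s) (x : ℝ) :
    ContinuousWithinAt (spectralDensity f) (Set.Ici x) x := by
  rcases lt_or_ge x 0 with hx | hx
  · refine ContinuousAt.continuousWithinAt ?_
    refine (continuousAt_const (y := (0 : ℝ))).congr ?_
    filter_upwards [Iio_mem_nhds hx] with t ht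
    exact (if_neg (not_le.2 ht)).symm
  · have hsq : Tendsto (fun t : ℝ => t ^ 2) (𝓝[≥] x) (𝓝[≥] (x ^ 2)) := by
      refine tendsto_nhdsWithin_iff.2 ⟨?_, ?_⟩
      · exact ((continuous_pow 2).tendsto x).mono_left nhdsWithin_le_nhds
      · filter_upwards [self_mem_nhdsWithin] with t ht
        have : x ≤ t := ht
        exact Set.mem_Ici.2 (by gcongr)
    have hmain : ContinuousWithinAt
        (fun t : ℝ => vnDim (spectralSubspace (f.adjoint ∘L f) (t ^ 2))) (Set.Ici x) x := by
      simp only [vnDim_eq]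
      refine tendsto_finsetSum _ fun i _ => ?_
      exact (((tendsto_spectralProjection (f.adjoint ∘L f) (x ^ 2) _).comp hsq).norm).pow 2
    refine hmain.congr (fun t ht => if_pos (hx.trans ht)) (if_pos hx)

/-- The spectral density function as a monotone right-continuous function; its Stieltjes measure
is the measure `dF` with `dF(]a,b]) = F(b) - F(a)`. -/
def spectralStieltjes {r s : ℕ} (f : L2Pow G r →L[ℂ] L2Pow G s) : StieltjesFunction ℝ where
  toFun := spectralDensity f
  mono' := spectralDensity_mono f
  right_continuous' := spectralDensity_rightCont f

open scoped Classical in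
/-- The Fuglede-Kadison determinant `exp (∫_{0+}^∞ ln(t) dF(t))` of a bounded operator
`f : L²(G)^r → L²(G)^s`, where `F` is the spectral density function of `f`; it is `0` if the
integral does not converge to a real number. -/
def fkDet {r s : ℕ} (f : L2Pow G r →L[ℂ] L2Pow G s) : ℝ :=
  if IntegrableOn Real.log (Set.Ioi 0) (spectralStieltjes f).measure then
    Real.exp (∫ t in Set.Ioi 0, Real.log t ∂(spectralStieltjes f).measure)
  else 0

/-! ### The Lehmer constants -/

/-- `Λ(G)`: the infimum of the determinants `> 1` of matrices over `ℤG` of arbitrary size. -/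
def lehmer (G : Type u) [Group G] : ℝ :=
  sInf {d : ℝ | 1 < d ∧ ∃ r s : ℕ, 1 ≤ r ∧ 1 ≤ s ∧
    ∃ A : Matrix (Fin r) (Fin s) (MonoidAlgebra ℤ G), fkDet (rightMulMatrix A) = d}

/-- `Λ₁(G)`: the infimum of the determinants `> 1` of `(1,1)`-matrices over `ℤG`. -/
def lehmerOne (G : Type u) [Group G] : ℝ :=
  sInf {d : ℝ | 1 < d ∧
    ∃ A : Matrix (Fin 1) (Fin 1) (MonoidAlgebra ℤ G), fkDet (rightMulMatrix A) = d}

/-- `Λ^w(G)`: the infimum of the determinants `> 1` of square matrices over `ℤG` which induce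
weak isomorphisms. -/
def lehmerWeak (G : Type u) [Group G] : ℝ :=
  sInf {d : ℝ | 1 < d ∧ ∃ r : ℕ, 1 ≤ r ∧ ∃ A : Matrix (Fin r) (Fin r) (MonoidAlgebra ℤ G),
    IsWeakIso (rightMulMatrix A) ∧ fkDet (rightMulMatrix A) = d}

/-- `Λ₁^w(G)`: the infimum of the determinants `> 1` of `(1,1)`-matrices over `ℤG` which induce
weak isomorphisms. -/
def lehmerWeakOne (G : Type u) [Group G] : ℝ :=
  sInf {d : ℝ | 1 < d ∧ ∃ A : Matrix (Fin 1) (Fin 1) (MonoidAlgebra ℤ G),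
    IsWeakIso (rightMulMatrix A) ∧ fkDet (rightMulMatrix A) = d}

end Lehmer

end

/-!
If `H ≤ G`, the operator of a matrix over `ℤH`, regarded as a matrix over `ℤG`, restricts to the
original operator on the reducing subspaces `L²(H)^r` and `L²(H)^s`, whose left translates span.
Hence neither the spectral density function nor the weak isomorphism property changes, which gives
the inequality for subgroups; the finitely generated case follows because a matrix involves finitely
many group elements. If `[G : H] = n`, a matrix over `ℤG` acts on `L²(G)^r ≅ L²(H)^(rn)` through a
matrix over `ℤH`; this multiplies the spectral density function by `n` and raises the determinant to
the `n`-th power.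

For finite `G`, the operator of `A` has an integral matrix `M` of size `s|G| × r|G|`, and
`det(r_A)^(2|G|)` is the product of the nonzero eigenvalues of `Mᵀ M`, up to sign the lowest nonzero
coefficient of its characteristic polynomial and therefore an integer. For weak isomorphisms already
`det(r_A)^|G| = |det M|` is an integer. The upper bounds come from the elements `2`, `(1, 1)`,
`∑_{g ≠ 1} g`, and, over `ℤ/2 = {1, τ}`, `2 + τ` and `1 + τ`. Over `ℤ/2`, `det M` is
`det (B + C) * det (B - C)` for `A = B + C τ`; the two factors have the same parity, so `|det M|`
cannot be `2`.
-/

noncomputable section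

namespace Lehmer

/-! ### Intertwiners and spectral projections -/

section Intertwining

variable {E F : Type*} [NormedAddCommGroup E] [InnerProductSpace ℂ E] [CompleteSpace E]
  [NormedAddCommGroup F] [InnerProductSpace ℂ F] [CompleteSpace F]
  {S : E →L[ℂ] E} {T : F →L[ℂ] F} {ι : E →L[ℂ] F}

lemma cfcHom_comp_intertwine (hS : IsSelfAdjoint S) (hT : IsSelfAdjoint T)
    (h : T ∘L ι = ι ∘L S) {s : Set ℝ} [CompactSpace s] (hSs : spectrum ℝ S ⊆ s)
    (hTs : spectrum ℝ T ⊆ s) (f : C(s, ℝ)) :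
    cfcHom hT (f.comp (.inclusion hTs)) ∘L ι = ι ∘L cfcHom hS (f.comp (.inclusion hSs)) := by
  have hid : cfcHom hT (.restrict _ (.id ℝ)) ∘L ι = ι ∘L cfcHom hS (.restrict _ (.id ℝ)) := by
    rw [cfcHom_id, cfcHom_id, h]
  induction f using ContinuousMap.induction_on_of_compact with
  | const c =>
    have hc : algebraMap ℝ (F →L[ℂ] F) c ∘L ι = ι ∘L algebraMap ℝ (E →L[ℂ] E) c := by
      ext v
      simp [Algebra.algebraMap_eq_smul_one]
    rw [← AlgHomClass.commutes (cfcHom hS) c, ← AlgHomClass.commutes (cfcHom hT) c] at hc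
    exact hc
  | id => exact hid
  | star_id => exact hid
  | add f g hf hg =>
    simp only [ContinuousMap.add_comp, map_add, ContinuousLinearMap.add_comp,
      ContinuousLinearMap.comp_add, hf, hg]
  | mul f g hf hg =>
    simp only [ContinuousMap.mul_comp, map_mul, ContinuousLinearMap.mul_def]
    rw [ContinuousLinearMap.comp_assoc, hg, ← ContinuousLinearMap.comp_assoc, hf,
      ContinuousLinearMap.comp_assoc]
  | frequently f hf =>
    have hclosed : IsClosed {f : C(s, ℝ) | cfcHom hT (f.comp (.inclusion hTs)) ∘L ι =
        ι ∘L cfcHom hS (f.comp (.inclusion hSs))} :=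
      isClosed_eq
        (((cfcHom_continuous hT).comp (ContinuousMap.continuous_precomp _)).clm_comp
          continuous_const)
        (continuous_const.clm_comp
          ((cfcHom_continuous hS).comp (ContinuousMap.continuous_precomp _)))
    exact hclosed.closure_subset (mem_closure_iff_frequently.2 hf)

lemma cfc_comp_intertwine (hS : IsSelfAdjoint S) (hT : IsSelfAdjoint T)
    (h : T ∘L ι = ι ∘L S) {φ : ℝ → ℝ} (hφ : ContinuousOn φ (spectrum ℝ S ∪ spectrum ℝ T)) :
    cfc φ T ∘L ι = ι ∘L cfc φ S := by
  have : CompactSpace ↥(spectrum ℝ S ∪ spectrum ℝ T) := isCompact_iff_compactSpace.1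
    ((spectrum.isCompact S).union (spectrum.isCompact T))
  rw [cfc_apply φ T hT (hφ.mono Set.subset_union_right),
    cfc_apply φ S hS (hφ.mono Set.subset_union_left)]
  exact cfcHom_comp_intertwine hS hT h Set.subset_union_left Set.subset_union_right
    ⟨_, hφ.domRestrict⟩

lemma starProjection_ker_intertwine (hS : IsSelfAdjoint S) (hT : IsSelfAdjoint T)
    (h : T ∘L ι = ι ∘L S) (v : E) :
    T.ker.starProjection (ι v) = ι (S.ker.starProjection v) := by
  have h' : S ∘L ι.adjoint = ι.adjoint ∘L T := by
    simpa only [ContinuousLinearMap.adjoint_comp, hS.adjoint_eq, hT.adjoint_eq] using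
      (congrArg ContinuousLinearMap.adjoint h).symm
  refine Submodule.eq_starProjection_of_mem_orthogonal ?_ fun u hu => ?_
  · have hv : S (S.ker.starProjection v) = 0 := S.ker.starProjection_apply_mem v
    exact (DFunLike.congr_fun h _).trans (by simp [hv])
  · have hu' : ι.adjoint u ∈ S.ker := by
      have : T u = 0 := hu
      exact (DFunLike.congr_fun h' u).trans (by simp [this])
    rw [← map_sub, ← ContinuousLinearMap.adjoint_inner_left]
    exact S.ker.sub_starProjection_mem_orthogonal v _ hu'

lemma starProjection_spectralSubspace_intertwine (hS : IsSelfAdjoint S) (hT : IsSelfAdjoint T)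
    (h : T ∘L ι = ι ∘L S) (μ : ℝ) (v : E) :
    (spectralSubspace T μ).starProjection (ι v) = ι ((spectralSubspace S μ).starProjection v) :=
  starProjection_ker_intertwine (cfc_predicate _ S) (cfc_predicate _ T)
    (cfc_comp_intertwine hS hT h (by fun_prop)) v

-- An eigenvector is an intertwiner `ℂ → E` from a scalar operator on `ℂ`.
lemma starProjection_spectralSubspace_eigenvector (hS : IsSelfAdjoint S) {b : E} {l : ℝ}
    (hb : S b = (l : ℂ) • b) (μ : ℝ) :
    (spectralSubspace S μ).starProjection b = if l ≤ μ then b else 0 := by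
  let ι : ℂ →L[ℂ] E := .toSpanSingleton ℂ b
  let L : ℂ →L[ℂ] ℂ := algebraMap ℝ _ l
  have hL : IsSelfAdjoint L := .algebraMap _ (.all l)
  have h : S ∘L ι = ι ∘L L := by ext; simp [ι, L, hb, Algebra.algebraMap_eq_smul_one]
  have hι : ι 1 = b := by simp [ι]
  have hmem : ∀ z : ℂ, z ∈ spectralSubspace L μ ↔ max (l - μ) 0 • z = 0 := fun z => by
    rw [spectralSubspace, cfc_algebraMap, LinearMap.mem_ker]
    simp [Algebra.algebraMap_eq_smul_one]
  have key := starProjection_spectralSubspace_intertwine hL hS h μ 1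
  rw [hι] at key
  rw [key]
  split_ifs with hlμ
  · rw [Submodule.starProjection_eq_self_iff.2, hι]
    rw [hmem, max_eq_right (sub_nonpos.2 hlμ), zero_smul]
  · have hpos : 0 < l - μ := sub_pos.2 (not_le.1 hlμ)
    have hbot : spectralSubspace L μ = ⊥ := (Submodule.eq_bot_iff _).2 fun z hz => by
      rw [hmem, max_eq_left hpos.le] at hz
      exact (smul_eq_zero.1 hz).resolve_left hpos.ne'
    rw [(Submodule.starProjection_apply_eq_zero_iff _).2 (by simp [hbot]), map_zero]

end Intertwining

/-! ### Restrictions of operators to reducing subspaces -/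

section Restriction

variable {E F E' F' : Type*}
  [NormedAddCommGroup E] [InnerProductSpace ℂ E] [CompleteSpace E]
  [NormedAddCommGroup F] [InnerProductSpace ℂ F] [CompleteSpace F]
  [NormedAddCommGroup E'] [InnerProductSpace ℂ E'] [CompleteSpace E']
  [NormedAddCommGroup F'] [InnerProductSpace ℂ F'] [CompleteSpace F']

/-- The operator `f` maps the image of the isometry `U` into that of the isometry `V` and acts
there as `f'`, and likewise for the adjoints: `f'` is the restriction of `f` to a pair of reducing
subspaces. -/
structure IsRestriction (f : E →L[ℂ] F) (f' : E' →L[ℂ] F') (U : E' →ₗᵢ[ℂ] E)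
    (V : F' →ₗᵢ[ℂ] F) : Prop where
  map_apply (x : E') : f (U x) = V (f' x)
  adjoint_apply (y : F') : f.adjoint (V y) = U (f'.adjoint y)

variable {f : E →L[ℂ] F} {f' : E' →L[ℂ] F'} {U : E' →ₗᵢ[ℂ] E} {V : F' →ₗᵢ[ℂ] F}

namespace IsRestriction

lemma adjoint (h : IsRestriction f f' U V) : IsRestriction f.adjoint f'.adjoint V U where
  map_apply := h.adjoint_apply
  adjoint_apply := by simpa only [ContinuousLinearMap.adjoint_adjoint] using h.map_apply

lemma norm_starProjection (h : IsRestriction f f' U V) (μ : ℝ) (x : E') :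
    ‖(spectralSubspace (f.adjoint ∘L f) μ).starProjection (U x)‖ =
      ‖(spectralSubspace (f'.adjoint ∘L f') μ).starProjection x‖ := by
  have hcomp : (f.adjoint ∘L f) ∘L U.toContinuousLinearMap =
      U.toContinuousLinearMap ∘L (f'.adjoint ∘L f') := by
    ext x
    simp [h.map_apply, h.adjoint_apply]
  have := starProjection_spectralSubspace_intertwine
    (ContinuousLinearMap.isPositive_adjoint_comp_self f').isSelfAdjoint
    (ContinuousLinearMap.isPositive_adjoint_comp_self f).isSelfAdjoint hcomp μ x
  exact (congrArg norm this).trans (U.norm_map _)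

lemma injective (h : IsRestriction f f' U V) (hf : Function.Injective f) :
    Function.Injective f' := by
  have := hf.comp U.injective
  rw [show f ∘ U = V ∘ f' from funext h.map_apply] at this
  exact this.of_comp

/-- The adjoint of `U` maps the kernel of `f` to that of `f'`. -/
lemma inner_eq_zero (h : IsRestriction f f' U V) (hf' : Function.Injective f') {x : E}
    (hx : f x = 0) (y : E') : ⟪U y, x⟫_ℂ = 0 := by
  suffices U.toContinuousLinearMap.adjoint x = 0 by
    rw [← U.coe_toContinuousLinearMap, ← ContinuousLinearMap.adjoint_inner_right, this,
      inner_zero_right]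
  refine (injective_iff_map_eq_zero f').1 hf' _ (ext_inner_left ℂ fun z => ?_)
  rw [← ContinuousLinearMap.adjoint_inner_left, ContinuousLinearMap.adjoint_inner_right,
    U.coe_toContinuousLinearMap, ← h.adjoint_apply, ContinuousLinearMap.adjoint_inner_left, hx,
    inner_zero_right, inner_zero_right]

end IsRestriction

end Restriction

/-! ### Embeddings along Hilbert bases -/

section BasisEmbedding

variable {E F : Type*} [NormedAddCommGroup E] [InnerProductSpace ℂ E]
  [NormedAddCommGroup F] [InnerProductSpace ℂ F] {ι κ : Type*} {σ : ι → κ}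

lemma ext_inner_hilbertBasis (b : HilbertBasis ι ℂ E) {x y : E}
    (h : ∀ i, ⟪b i, x⟫_ℂ = ⟪b i, y⟫_ℂ) : x = y :=
  b.repr.injective (lp.ext (funext fun i => by simpa only [b.repr_apply_apply] using h i))

lemma continuousLinearMap_ext_hilbertBasis (b : HilbertBasis ι ℂ E) {f g : E →L[ℂ] F}
    (h : ∀ i, f (b i) = g (b i)) : f = g :=
  ContinuousLinearMap.ext_on ((Submodule.dense_iff_topologicalClosure_eq_top).2 b.dense_span)
    (by rintro _ ⟨i, rfl⟩; exact h i)

variable [CompleteSpace F]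

/-- The isometry which maps the vector `b i` of a Hilbert basis to the vector `c (σ i)`. -/
def basisEmbedding (b : HilbertBasis ι ℂ E) (c : HilbertBasis κ ℂ F) (hσ : σ.Injective) :
    E →ₗᵢ[ℂ] F :=
  (c.orthonormal.comp σ hσ).orthogonalFamily.linearIsometry.comp b.repr.toLinearIsometry

variable {b : HilbertBasis ι ℂ E} {c : HilbertBasis κ ℂ F} {hσ : σ.Injective}

@[simp]
lemma basisEmbedding_apply (i : ι) : basisEmbedding b c hσ (b i) = c (σ i) := by
  classical
  have h : b.repr.toLinearIsometry (b i) = lp.single 2 i 1 := b.repr_self i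
  rw [basisEmbedding, LinearIsometry.coe_comp, Function.comp_apply, h,
    OrthogonalFamily.linearIsometry_apply_single]
  simp

lemma inner_basisEmbedding_of_notMem {k : κ} (hk : k ∉ Set.range σ) (x : E) :
    ⟪c k, basisEmbedding b c hσ x⟫_ℂ = 0 := by
  suffices innerSL ℂ (c k) ∘L (basisEmbedding b c hσ).toContinuousLinearMap = 0 from
    DFunLike.congr_fun this x
  refine continuousLinearMap_ext_hilbertBasis b fun i => ?_
  simpa using c.orthonormal.2 fun h : k = σ i => hk ⟨i, h.symm⟩

lemma inner_basisEmbedding (i : ι) (x : E) :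
    ⟪c (σ i), basisEmbedding b c hσ x⟫_ℂ = ⟪b i, x⟫_ℂ := by
  rw [← basisEmbedding_apply (b := b) (c := c) (hσ := hσ), LinearIsometry.inner_map_map]

lemma map_basisEmbedding_apply {E' F' : Type*} [NormedAddCommGroup E'] [InnerProductSpace ℂ E']
    [NormedAddCommGroup F'] [InnerProductSpace ℂ F'] [CompleteSpace E'] {ι' κ' : Type*}
    {f : E' →L[ℂ] F} {f' : E →L[ℂ] F'} {b' : HilbertBasis ι' ℂ E'} {c' : HilbertBasis κ' ℂ F'}
    {σ : ι → ι'} {τ : κ' → κ} {hσ : σ.Injective} {hτ : τ.Injective}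
    (h : ∀ p q, ⟪c (τ p), f (b' (σ q))⟫_ℂ = ⟪c' p, f' (b q)⟫_ℂ)
    (hτf : ∀ p ∉ Set.range τ, ∀ q, ⟪c p, f (b' (σ q))⟫_ℂ = 0) (x : E) :
    f (basisEmbedding b b' hσ x) = basisEmbedding c' c hτ (f' x) := by
  suffices f ∘L (basisEmbedding b b' hσ).toContinuousLinearMap =
      (basisEmbedding c' c hτ).toContinuousLinearMap ∘L f' from DFunLike.congr_fun this x
  refine continuousLinearMap_ext_hilbertBasis b fun q => ext_inner_hilbertBasis c fun p => ?_
  simp only [ContinuousLinearMap.comp_apply, LinearIsometry.coe_toContinuousLinearMap,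
    basisEmbedding_apply]
  by_cases hp : p ∈ Set.range τ
  · obtain ⟨p, rfl⟩ := hp
    rw [h, inner_basisEmbedding]
  · rw [hτf p hp, inner_basisEmbedding_of_notMem hp]

lemma isRestriction_basisEmbedding {E' F' : Type*} [NormedAddCommGroup E']
    [InnerProductSpace ℂ E'] [CompleteSpace E'] [NormedAddCommGroup F'] [InnerProductSpace ℂ F']
    [CompleteSpace F'] [CompleteSpace E] {ι' κ' : Type*} {f : E →L[ℂ] F} {f' : E' →L[ℂ] F'}
    {b' : HilbertBasis ι' ℂ E'} {c' : HilbertBasis κ' ℂ F'} {σ : ι' → ι} {τ : κ' → κ}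
    {hσ : σ.Injective} {hτ : τ.Injective}
    (h : ∀ p q, ⟪c (τ p), f (b (σ q))⟫_ℂ = ⟪c' p, f' (b' q)⟫_ℂ)
    (hτf : ∀ p ∉ Set.range τ, ∀ q, ⟪c p, f (b (σ q))⟫_ℂ = 0)
    (hσf : ∀ q ∉ Set.range σ, ∀ p, ⟪c (τ p), f (b q)⟫_ℂ = 0) :
    IsRestriction f f' (basisEmbedding b' b hσ) (basisEmbedding c' c hτ) where
  map_apply := map_basisEmbedding_apply h hτf
  adjoint_apply := by
    refine map_basisEmbedding_apply (fun q p => ?_) fun q hq p => ?_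
    · rw [ContinuousLinearMap.adjoint_inner_right, ContinuousLinearMap.adjoint_inner_right,
        ← inner_conj_symm, h, inner_conj_symm]
    · rw [ContinuousLinearMap.adjoint_inner_right, ← inner_conj_symm, hσf q hq, map_zero]

end BasisEmbedding

/-! ### The standard Hilbert basis and equivariant operators -/

section StandardBasis

variable {G : Type u} {r : ℕ}

/-- The element `g` of `G ⊆ L²(G)` in position `i`, where `p = (i, g)`. -/
def stdVec (p : Fin r × G) : L2Pow G r :=
  open scoped Classical in PiLp.single 2 p.1 (lp.single 2 p.2 (1 : ℂ))

lemma inner_stdVec (p : Fin r × G) (x : L2Pow G r) : ⟪stdVec p, x⟫_ℂ = x p.1 p.2 := by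
  classical
  rw [stdVec, PiLp.inner_apply, Finset.sum_eq_single_of_mem p.1 (Finset.mem_univ _)]
  · rw [PiLp.single_apply, if_pos rfl, lp.inner_single_left]
    simp
  · intro i _ hi
    simp [hi]

lemma stdVec_apply_apply [DecidableEq G] (p : Fin r × G) (i : Fin r) (g : G) :
    (stdVec p : L2Pow G r) i g = if (i, g) = p then 1 else 0 := by
  obtain ⟨j, h⟩ := p
  by_cases hij : i = j
  · subst hij
    simp [stdVec, Pi.single_apply]
  · simp [stdVec, hij]

lemma orthonormal_stdVec : Orthonormal ℂ (stdVec : Fin r × G → L2Pow G r) := by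
  classical
  refine orthonormal_iff_ite.2 fun p q => ?_
  rw [inner_stdVec, stdVec_apply_apply]

/-- The standard Hilbert basis of `L²(G)^r`. -/
def stdBasis (G : Type u) (r : ℕ) : HilbertBasis (Fin r × G) ℂ (L2Pow G r) :=
  .mkOfOrthogonalEqBot orthonormal_stdVec <| (Submodule.eq_bot_iff _).2 fun x hx =>
    PiLp.ext fun i => lp.ext <| funext fun g => by
      rw [← inner_stdVec (i, g)]
      exact hx _ (Submodule.subset_span ⟨_, rfl⟩)

lemma stdBasis_apply (p : Fin r × G) : stdBasis G r p = stdVec p :=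
  congrFun (HilbertBasis.coe_mkOfOrthogonalEqBot _ _) p

lemma inner_stdBasis (p : Fin r × G) (x : L2Pow G r) : ⟪stdBasis G r p, x⟫_ℂ = x p.1 p.2 := by
  rw [stdBasis_apply, inner_stdVec]

lemma unitVec_eq_stdBasis [Group G] (i : Fin r) : unitVec G r i = stdBasis G r (i, 1) :=
  (stdBasis_apply (i, (1 : G))).symm

end StandardBasis

section Equivariant

variable {G : Type u} {r s : ℕ}

lemma isWeakIso_iff_injective (f : L2Pow G r →L[ℂ] L2Pow G s) :
    IsWeakIso f ↔ Function.Injective f ∧ Function.Injective f.adjoint := by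
  have hdense : DenseRange f ↔ f.range.topologicalClosure = ⊤ :=
    Submodule.dense_iff_topologicalClosure_eq_top (s := f.range)
  rw [IsWeakIso, hdense, Submodule.topologicalClosure_eq_top_iff,
    ContinuousLinearMap.orthogonal_range, LinearMap.ker_eq_bot]
  rfl

variable [Group G] {f : L2Pow G r →L[ℂ] L2Pow G s}

/-- Left translation by `g` on `L²(G)^r`. -/
def leftTranslate (r : ℕ) (g : G) : L2Pow G r →ₗᵢ[ℂ] L2Pow G r :=
  basisEmbedding (stdBasis G r) (stdBasis G r)
    (Function.injective_id.prodMap (mul_right_injective g))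

@[simp]
lemma leftTranslate_stdBasis (g : G) (p : Fin r × G) :
    leftTranslate r g (stdBasis G r p) = stdBasis G r (p.1, g * p.2) :=
  basisEmbedding_apply p

/-- A `G`-equivariant operator. The condition on the adjoint which is part of `IsRestriction` is
automatic here, because left translations are unitary. -/
def IsEquivariant (f : L2Pow G r →L[ℂ] L2Pow G s) : Prop :=
  ∀ g, IsRestriction f f (leftTranslate r g) (leftTranslate s g)

lemma isEquivariant_of_inner
    (h : ∀ g p q, ⟪stdBasis G s (p.1, g * p.2), f (stdBasis G r (q.1, g * q.2))⟫_ℂ =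
      ⟪stdBasis G s p, f (stdBasis G r q)⟫_ℂ) : IsEquivariant f := by
  have hsurj : ∀ (n : ℕ) (g : G), (Prod.map (id : Fin n → Fin n) (g * ·)).Surjective :=
    fun n g => Function.surjective_id.prodMap (mul_left_surjective g)
  exact fun g => isRestriction_basisEmbedding (h g)
    (fun p hp => (hp (hsurj s g p)).elim) fun q hq => (hq (hsurj r g q)).elim

namespace IsEquivariant

lemma adjoint (hf : IsEquivariant f) : IsEquivariant f.adjoint := fun g => (hf g).adjoint

lemma norm_starProjection_stdBasis (hf : IsEquivariant f) (μ : ℝ) (p : Fin r × G) :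
    ‖(spectralSubspace (f.adjoint ∘L f) μ).starProjection (stdBasis G r p)‖ =
      ‖(spectralSubspace (f.adjoint ∘L f) μ).starProjection (unitVec G r p.1)‖ := by
  rw [← (hf p.2).norm_starProjection _ (unitVec G r p.1), unitVec_eq_stdBasis,
    leftTranslate_stdBasis, mul_one]

end IsEquivariant

variable {H : Type*} {r' s' : ℕ} {f' : L2Pow H r' →L[ℂ] L2Pow H s'}
  {σ : Fin r' × H → Fin r × G} {τ : Fin s' × H → Fin s × G} {hσ : σ.Injective} {hτ : τ.Injective}

lemma injective_iff_of_isRestriction (hf : IsEquivariant f)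
    {V : L2Pow H s' →ₗᵢ[ℂ] L2Pow G s}
    (h : IsRestriction f f' (basisEmbedding (stdBasis H r') (stdBasis G r) hσ) V)
    (hσ' : ∀ i, ∃ p, (σ p).1 = i) : Function.Injective f ↔ Function.Injective f' := by
  refine ⟨h.injective, fun hf' => (injective_iff_map_eq_zero f).2 fun x hx => ?_⟩
  refine ext_inner_hilbertBasis (stdBasis G r) fun q => ?_
  obtain ⟨p, hp⟩ := hσ' q.1
  set g := (σ p).2 * q.2⁻¹ with hg
  have hgx : f (leftTranslate r g x) = 0 := by rw [(hf g).map_apply, hx, map_zero]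
  calc ⟪stdBasis G r q, x⟫_ℂ
      = ⟪stdBasis G r (σ p), leftTranslate r g x⟫_ℂ := by
        rw [← (leftTranslate r g).inner_map_map, leftTranslate_stdBasis, ← hp, hg,
          inv_mul_cancel_right]
    _ = 0 := by rw [← h.inner_eq_zero hf' hgx (stdBasis H r' p), basisEmbedding_apply]
    _ = ⟪stdBasis G r q, 0⟫_ℂ := (inner_zero_right _).symm

lemma isWeakIso_iff_of_isRestriction (hf : IsEquivariant f)
    (h : IsRestriction f f' (basisEmbedding (stdBasis H r') (stdBasis G r) hσ)
      (basisEmbedding (stdBasis H s') (stdBasis G s) hτ))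
    (hσ' : ∀ i, ∃ p, (σ p).1 = i) (hτ' : ∀ i, ∃ p, (τ p).1 = i) :
    IsWeakIso f ↔ IsWeakIso f' := by
  rw [isWeakIso_iff_injective, isWeakIso_iff_injective, injective_iff_of_isRestriction hf h hσ',
    injective_iff_of_isRestriction hf.adjoint h.adjoint hτ']

variable [Group H]

lemma spectralDensity_eq_of_isRestriction (hf : IsEquivariant f)
    (h : IsRestriction f f' (basisEmbedding (stdBasis H r') (stdBasis G r) hσ)
      (basisEmbedding (stdBasis H s') (stdBasis G s) hτ)) {t : ℝ} (ht : 0 ≤ t) :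
    spectralDensity f' t = ∑ i, ‖(spectralSubspace (f.adjoint ∘L f) (t ^ 2)).starProjection
      (unitVec G r (σ (i, 1)).1)‖ ^ 2 := by
  rw [spectralDensity, if_pos ht, vnDim_eq]
  refine Finset.sum_congr rfl fun i _ => ?_
  rw [unitVec_eq_stdBasis, ← h.norm_starProjection, basisEmbedding_apply,
    hf.norm_starProjection_stdBasis]

end Equivariant

/-! ### Right multiplication operators -/

section RightMul

variable {G : Type u} [Group G] {r s : ℕ}

lemma rightMul_single [DecidableEq G] (a : MonoidAlgebra ℤ G) (g h : G) :
    rightMul a (lp.single 2 h 1) g = a.coeff (h⁻¹ * g) := by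
  rw [rightMul, Finsupp.sum, sum_apply, lp.coeFn_sum, Finset.sum_apply,
    Finset.sum_eq_single (h⁻¹ * g)]
  · simp [rightTranslate]
  · intro k _ hk
    have : g * k⁻¹ ≠ h := fun hgk => hk (by rw [← hgk]; group)
    simp [rightTranslate, this]
  · intro hk
    simp [Finsupp.notMem_support_iff.1 hk]

/-- The matrix of `r_A^{(2)}` with respect to the standard Hilbert bases. -/
def rightMulCoeff (A : Matrix (Fin r) (Fin s) (MonoidAlgebra ℤ G)) :
    Matrix (Fin s × G) (Fin r × G) ℤ :=
  .of fun p q => (A q.1 p.1).coeff (q.2⁻¹ * p.2)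

variable (A : Matrix (Fin r) (Fin s) (MonoidAlgebra ℤ G))

lemma inner_rightMulMatrix (p : Fin s × G) (q : Fin r × G) :
    ⟪stdBasis G s p, rightMulMatrix A (stdBasis G r q)⟫_ℂ = rightMulCoeff A p q := by
  classical
  have hq : ∀ k, (stdBasis G r q) k = if k = q.1 then lp.single 2 q.2 1 else 0 := fun k => by
    rw [stdBasis_apply, stdVec, PiLp.single_apply]
  rw [inner_stdBasis]
  have : rightMulMatrix A (stdBasis G r q) p.1 = rightMul (A q.1 p.1) (lp.single 2 q.2 1) := by
    simp [rightMulMatrix, hq, apply_ite]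
  rw [this, rightMul_single]
  rfl

lemma isEquivariant_rightMulMatrix : IsEquivariant (rightMulMatrix A) :=
  isEquivariant_of_inner fun g p q => by
    simp [inner_rightMulMatrix, rightMulCoeff, mul_assoc]

end RightMul

/-! ### Determinants and spectral measures -/

section Determinant

open scoped Classical in
/-- The functional `μ ↦ exp (∫_{0+}^∞ ln(t) dμ(t))`, with value `0` if the integral does not
converge; the Fuglede-Kadison determinant is its value at the spectral measure. -/
def expIntegralLog (μ : Measure ℝ) : ℝ :=
  if IntegrableOn Real.log (Set.Ioi 0) μ then Real.exp (∫ t in Set.Ioi 0, Real.log t ∂μ) else 0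

lemma expIntegralLog_smul (μ : Measure ℝ) {n : ℕ} (hn : n ≠ 0) :
    expIntegralLog ((n : ℝ≥0∞) • μ) = expIntegralLog μ ^ n := by
  have hiff : IntegrableOn Real.log (Set.Ioi 0) ((n : ℝ≥0∞) • μ) ↔
      IntegrableOn Real.log (Set.Ioi 0) μ := by
    rw [IntegrableOn, Measure.restrict_smul, integrable_smul_measure (Nat.cast_ne_zero.2 hn)
      (ENNReal.natCast_ne_top n), IntegrableOn]
  rw [expIntegralLog, expIntegralLog]
  split_ifs with h1 h2 h2
  · rw [Measure.restrict_smul, integral_smul_measure, ENNReal.toReal_natCast, smul_eq_mul,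
      Real.exp_nat_mul]
  · exact absurd (hiff.1 h1) h2
  · exact absurd (hiff.2 h2) h1
  · rw [zero_pow hn]

lemma expIntegralLog_sum_dirac {ι : Type*} [Fintype ι] (x : ι → ℝ) :
    expIntegralLog (∑ i, Measure.dirac (x i)) = ∏ i, if 0 < x i then x i else 1 := by
  have h_integrable : ∀ i ∈ Finset.univ, Integrable ((Set.Ioi 0).indicator Real.log)
      (Measure.dirac (x i)) := fun i _ => integrable_dirac (by simp)
  have hsum : IntegrableOn Real.log (Set.Ioi 0) (∑ i, Measure.dirac (x i)) := by
    rw [← integrable_indicator_iff measurableSet_Ioi]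
    exact integrable_finsetSum_measure.2 h_integrable
  rw [expIntegralLog, if_pos hsum, ← integral_indicator measurableSet_Ioi,
    integral_finsetSum_measure h_integrable, Real.exp_sum]
  refine Finset.prod_congr rfl fun i _ => ?_
  rw [integral_dirac]
  simp only [Set.indicator_apply, Set.mem_Ioi]
  split_ifs with hi
  · exact Real.exp_log hi
  · exact Real.exp_zero

lemma measure_natCast_smul (F : StieltjesFunction ℝ) (n : ℕ) :
    ((n : NNReal) • F).measure = (n : ℝ≥0∞) • F.measure := by
  rw [StieltjesFunction.measure_smul, ← ENNReal.coe_natCast]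
  rfl

lemma measure_eq_sum_dirac {F : StieltjesFunction ℝ} {ι : Type*} [Fintype ι] {x : ι → ℝ}
    (h : ∀ t, F t = ∑ i, if x i ≤ t then 1 else 0) : F.measure = ∑ i, Measure.dirac (x i) := by
  refine Measure.ext_of_Ioc _ _ fun a b hab => ?_
  have hstep : ∀ i, ((if x i ≤ b then 1 else 0) - if x i ≤ a then 1 else 0 : ℝ) =
      if x i ∈ Set.Ioc a b then 1 else 0 := fun i => by grind
  rw [StieltjesFunction.measure_Ioc, h, h, ← Finset.sum_sub_distrib, Measure.finsetSum_apply]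
  simp only [hstep]
  rw [ENNReal.ofReal_sum_of_nonneg fun i _ => by split_ifs <;> simp]
  refine Finset.sum_congr rfl fun i _ => ?_
  rw [Measure.dirac_apply' _ measurableSet_Ioc, Set.indicator_apply]
  split_ifs <;> simp

variable {G H : Type*} [Group G] [Group H] {r s r' s' : ℕ}

lemma fkDet_eq_pow {f : L2Pow G r →L[ℂ] L2Pow G s} {f' : L2Pow H r' →L[ℂ] L2Pow H s'} {n : ℕ}
    (hn : n ≠ 0) (h : ∀ t, 0 ≤ t → spectralDensity f' t = n * spectralDensity f t) :
    fkDet f' = fkDet f ^ n := by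
  have hF : spectralStieltjes f' = (n : NNReal) • spectralStieltjes f := by
    ext t
    change spectralDensity f' t = (n : NNReal) • spectralDensity f t
    rw [NNReal.smul_def, NNReal.coe_natCast, smul_eq_mul]
    by_cases ht : 0 ≤ t
    · exact h t ht
    · simp [spectralDensity, ht]
  calc fkDet f' = expIntegralLog (spectralStieltjes f').measure := rfl
    _ = fkDet f ^ n := by rw [hF, measure_natCast_smul, expIntegralLog_smul _ hn]; rfl

lemma fkDet_pow_eq_prod {f : L2Pow G r →L[ℂ] L2Pow G s} {n : ℕ} (hn : n ≠ 0) {ι : Type*}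
    [Fintype ι] {l : ι → ℝ}
    (h : ∀ t, 0 ≤ t → n * spectralDensity f t = ∑ i, if l i ≤ t ^ 2 then 1 else 0) :
    fkDet f ^ n = ∏ i, if 0 < l i then √(l i) else 1 := by
  have hF : ∀ t, ((n : NNReal) • spectralStieltjes f) t = ∑ i, if √(l i) ≤ t then 1 else 0 := by
    intro t
    change n * spectralDensity f t = _
    by_cases ht : 0 ≤ t
    · simp only [h t ht, Real.sqrt_le_left ht]
    · have : ∀ i, ¬ √(l i) ≤ t := fun i hi => ht ((Real.sqrt_nonneg _).trans hi)
      simp [spectralDensity, ht, this]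
  calc fkDet f ^ n = expIntegralLog ((n : ℝ≥0∞) • (spectralStieltjes f).measure) :=
        (expIntegralLog_smul _ hn).symm
    _ = _ := by
      rw [← measure_natCast_smul, measure_eq_sum_dirac hF, expIntegralLog_sum_dirac]
      simp only [Real.sqrt_pos]

end Determinant

/-! ### Induction and restriction -/

section Induction

variable {G H : Type*} [Group G] [Group H] {r s : ℕ}

/-- The matrix over `ℤG` induced by a matrix over `ℤH` and a homomorphism `H → G`. -/
def inducedMatrix (φ : H →* G) (A : Matrix (Fin r) (Fin s) (MonoidAlgebra ℤ H)) :
    Matrix (Fin r) (Fin s) (MonoidAlgebra ℤ G) :=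
  A.map (MonoidAlgebra.mapDomain φ)

variable {φ : H →* G}

lemma isRestriction_inducedMatrix (hφ : Function.Injective φ)
    (A : Matrix (Fin r) (Fin s) (MonoidAlgebra ℤ H)) :
    IsRestriction (rightMulMatrix (inducedMatrix φ A)) (rightMulMatrix A)
      (basisEmbedding (stdBasis H r) (stdBasis G r) (Function.injective_id.prodMap hφ))
      (basisEmbedding (stdBasis H s) (stdBasis G s) (Function.injective_id.prodMap hφ)) := by
  have hzero : ∀ k j, ∀ g ∉ Set.range φ, (inducedMatrix φ A k j).coeff g = 0 :=
    fun k j g hg => Finsupp.mapDomain_of_notMem_range _ _ hg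
  refine isRestriction_basisEmbedding (fun p q => ?_) (fun p hp q => ?_) fun q hq p => ?_
  · rw [inner_rightMulMatrix, inner_rightMulMatrix]
    have : rightMulCoeff (inducedMatrix φ A) (Prod.map id φ p) (Prod.map id φ q) =
        (inducedMatrix φ A q.1 p.1).coeff (φ (q.2⁻¹ * p.2)) := by simp [rightMulCoeff]
    rw [this]
    exact congrArg _ (Finsupp.mapDomain_apply hφ _ _)
  · rw [inner_rightMulMatrix, rightMulCoeff, Matrix.of_apply, hzero, Int.cast_zero]
    rintro ⟨h, hh⟩
    exact hp ⟨(p.1, q.2 * h), by simp [hh]⟩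
  · rw [inner_rightMulMatrix, rightMulCoeff, Matrix.of_apply, hzero, Int.cast_zero]
    rintro ⟨h, hh⟩
    exact hq ⟨(q.1, p.2 * h⁻¹), by simp [hh]⟩

lemma fkDet_inducedMatrix (hφ : Function.Injective φ)
    (A : Matrix (Fin r) (Fin s) (MonoidAlgebra ℤ H)) :
    fkDet (rightMulMatrix (inducedMatrix φ A)) = fkDet (rightMulMatrix A) := by
  rw [← pow_one (fkDet (rightMulMatrix A))]
  refine (fkDet_eq_pow one_ne_zero fun t ht => ?_).trans rfl
  rw [spectralDensity_eq_of_isRestriction (isEquivariant_rightMulMatrix _)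
    (isRestriction_inducedMatrix hφ A) ht, Nat.cast_one, one_mul, spectralDensity, if_pos ht,
    vnDim_eq]
  rfl

lemma isWeakIso_inducedMatrix_iff (hφ : Function.Injective φ)
    (A : Matrix (Fin r) (Fin s) (MonoidAlgebra ℤ H)) :
    IsWeakIso (rightMulMatrix (inducedMatrix φ A)) ↔ IsWeakIso (rightMulMatrix A) :=
  isWeakIso_iff_of_isRestriction (isEquivariant_rightMulMatrix _)
    (isRestriction_inducedMatrix hφ A) (fun i => ⟨(i, 1), rfl⟩) fun i => ⟨(i, 1), rfl⟩

lemma exists_fg_inducedMatrix (A : Matrix (Fin r) (Fin s) (MonoidAlgebra ℤ G)) :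
    ∃ K : Subgroup G, K.FG ∧ ∃ B : Matrix (Fin r) (Fin s) (MonoidAlgebra ℤ K),
      inducedMatrix K.subtype B = A := by
  classical
  let S : Finset G := Finset.univ.biUnion fun p : Fin r × Fin s => (A p.1 p.2).coeff.support
  refine ⟨Subgroup.closure S, ⟨S, rfl⟩, fun i j => MonoidAlgebra.comapDomain _
    (Subgroup.subtype_injective _) (A i j), ?_⟩
  ext1 i j
  refine MonoidAlgebra.mapDomain_comapDomain (fun g hg => ?_) _
  exact ⟨⟨g, Subgroup.subset_closure (Finset.mem_biUnion.2 ⟨(i, j), Finset.mem_univ _, hg⟩)⟩, rfl⟩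

end Induction

section FiniteIndex

variable {G : Type*} [Group G] {H : Subgroup G} {r s n : ℕ}

lemma exists_transversal (H : Subgroup G) [H.FiniteIndex] :
    ∃ t : Fin H.index → G, Function.Bijective fun p : H × Fin H.index => (p.1 : G) * t p.2 := by
  obtain ⟨T, hT, -⟩ := H.exists_isComplement_right 1
  have : Finite T := hT.finite_right
  let e : Fin H.index ≃ T := (Finite.equivFinOfCardEq hT.card_right).symm
  exact ⟨fun i => e i, hT.comp ((Equiv.refl H).prodCongr e).bijective⟩

/-- The position in the standard basis of `L²(G)^r` of a standard basis vector of `L²(H)^(rn)`,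
where `L²(G)` is identified with `L²(H)^n` through representatives `t` of the right cosets
of `H`. -/
def cosetIndex (H : Subgroup G) (t : Fin n → G) (r : ℕ) (p : Fin (r * n) × H) : Fin r × G :=
  (p.1.divNat, p.2 * t p.1.modNat)

/-- The matrix over `ℤH` which describes `r_A^{(2)}` as an operator `L²(H)^(rn) → L²(H)^(sn)`. -/
def restrictedMatrix (H : Subgroup G) (t : Fin n → G)
    (A : Matrix (Fin r) (Fin s) (MonoidAlgebra ℤ G)) :
    Matrix (Fin (r * n)) (Fin (s * n)) (MonoidAlgebra ℤ H) :=
  fun p q => MonoidAlgebra.comapDomain (fun h : H => (t p.modNat)⁻¹ * h * t q.modNat)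
    (fun a b h => by simpa using h) (A p.divNat q.divNat)

variable {t : Fin n → G} (ht : Function.Bijective fun p : H × Fin n => (p.1 : G) * t p.2)
include ht

lemma bijective_cosetIndex (r : ℕ) : Function.Bijective (cosetIndex H t r) := by
  let e : Fin (r * n) × H ≃ Fin r × H × Fin n :=
    (finProdFinEquiv.symm.prodCongr (.refl H)).trans
      ((Equiv.prodAssoc _ _ _).trans ((Equiv.refl _).prodCongr (.prodComm _ _)))
  exact (Function.bijective_id.prodMap ht).comp e.bijective

lemma isRestriction_restrictedMatrix (A : Matrix (Fin r) (Fin s) (MonoidAlgebra ℤ G)) :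
    IsRestriction (rightMulMatrix A) (rightMulMatrix (restrictedMatrix H t A))
      (basisEmbedding (stdBasis H (r * n)) (stdBasis G r) (bijective_cosetIndex ht r).1)
      (basisEmbedding (stdBasis H (s * n)) (stdBasis G s) (bijective_cosetIndex ht s).1) := by
  refine isRestriction_basisEmbedding (fun p q => ?_)
    (fun p hp => (hp ((bijective_cosetIndex ht s).2 p)).elim)
    (fun q hq => (hq ((bijective_cosetIndex ht r).2 q)).elim)
  rw [inner_rightMulMatrix, inner_rightMulMatrix]
  simp [rightMulCoeff, restrictedMatrix, cosetIndex, mul_assoc]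

lemma fkDet_restrictedMatrix (hn : n ≠ 0) (A : Matrix (Fin r) (Fin s) (MonoidAlgebra ℤ G)) :
    fkDet (rightMulMatrix (restrictedMatrix H t A)) = fkDet (rightMulMatrix A) ^ n := by
  refine fkDet_eq_pow hn fun x hx => ?_
  rw [spectralDensity_eq_of_isRestriction (isEquivariant_rightMulMatrix A)
    (isRestriction_restrictedMatrix ht A) hx, ← finProdFinEquiv.sum_comp, Fintype.sum_prod_type,
    spectralDensity, if_pos hx, vnDim_eq, Finset.mul_sum]
  refine Finset.sum_congr rfl fun i _ => ?_
  have hi : ∀ j : Fin n, (finProdFinEquiv (i, j)).divNat = i := fun j =>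
    congrArg Prod.fst (finProdFinEquiv.symm_apply_apply (i, j))
  simp [cosetIndex, hi]

lemma isWeakIso_restrictedMatrix_iff (A : Matrix (Fin r) (Fin s) (MonoidAlgebra ℤ G)) :
    IsWeakIso (rightMulMatrix A) ↔ IsWeakIso (rightMulMatrix (restrictedMatrix H t A)) := by
  have hfst : ∀ m i, ∃ p, (cosetIndex H t m p).1 = i := fun m i =>
    ((bijective_cosetIndex ht m).2 (i, 1)).imp fun p hp => by rw [hp]
  exact isWeakIso_iff_of_isRestriction (isEquivariant_rightMulMatrix A)
    (isRestriction_restrictedMatrix ht A) (hfst r) (hfst s)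

end FiniteIndex

/-! ### Finite groups -/

section FiniteDimensional

variable {E ι κ : Type*} [NormedAddCommGroup E] [InnerProductSpace ℂ E] [Fintype ι] [Fintype κ]

lemma sum_norm_sq_starProjection_eq (b : OrthonormalBasis ι ℂ E) (c : OrthonormalBasis κ ℂ E)
    (V : Submodule ℂ E) [V.HasOrthogonalProjection] :
    ∑ i, ‖V.starProjection (b i)‖ ^ 2 = ∑ j, ‖V.starProjection (c j)‖ ^ 2 := by
  simp_rw [← c.sum_sq_norm_inner_right (V.starProjection (b _)),
    ← b.sum_sq_norm_inner_left (V.starProjection (c _))]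
  rw [Finset.sum_comm]
  simp_rw [V.inner_starProjection_left_eq_right]

lemma sum_norm_sq_starProjection_spectralSubspace [FiniteDimensional ℂ E]
    (b : OrthonormalBasis ι ℂ E) {S : E →L[ℂ] E} (hS : IsSelfAdjoint S) (μ : ℝ) :
    ∑ i, ‖(spectralSubspace S μ).starProjection (b i)‖ ^ 2 =
      ∑ j, if hS.isSymmetric.eigenvalues rfl j ≤ μ then 1 else 0 := by
  rw [sum_norm_sq_starProjection_eq b (hS.isSymmetric.eigenvectorBasis rfl)]
  refine Finset.sum_congr rfl fun j _ => ?_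
  rw [starProjection_spectralSubspace_eigenvector hS
    (hS.isSymmetric.apply_eigenvectorBasis rfl j)]
  change ‖if hS.isSymmetric.eigenvalues rfl j ≤ μ then _ else _‖ ^ 2 = _
  split_ifs <;> simp

end FiniteDimensional

section TrailingCoeff

open Polynomial

lemma norm_trailingCoeff_prod_X_sub_C {ι : Type*} [Fintype ι] {l : ι → ℝ} (hl : ∀ i, 0 ≤ l i) :
    ‖(∏ i, (X - C (l i : ℂ))).trailingCoeff‖ = ∏ i, if 0 < l i then l i else 1 := by
  let φ : ℂ[X] →* ℂ := ⟨⟨trailingCoeff, by simp [trailingCoeff]⟩, trailingCoeff_mul⟩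
  have hprod : (∏ i, (X - C (l i : ℂ))).trailingCoeff = ∏ i, (X - C (l i : ℂ)).trailingCoeff :=
    map_prod φ _ _
  rw [hprod, norm_prod]
  refine Finset.prod_congr rfl fun i _ => ?_
  split_ifs with hi
  · rw [trailingCoeff_eq_coeff_zero] <;> simp [hi.ne', hi.le]
  · simp [le_antisymm (not_lt.1 hi) (hl i), trailingCoeff]

lemma trailingCoeff_map_of_injective {R S : Type*} [Semiring R] [Semiring S] {φ : R →+* S}
    (hφ : Function.Injective φ) (p : R[X]) : (p.map φ).trailingCoeff = φ p.trailingCoeff := by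
  rw [trailingCoeff, trailingCoeff, coeff_map, natTrailingDegree, natTrailingDegree,
    trailingDegree, trailingDegree, support_map_of_injective p hφ]

lemma abs_trailingCoeff_charpoly {m : Type*} [Fintype m] [DecidableEq m] {M : Matrix m m ℤ}
    (h : M.det ≠ 0) : |M.charpoly.trailingCoeff| = |M.det| := by
  rw [M.det_eq_sign_charpoly_coeff] at h ⊢
  rw [trailingCoeff_eq_coeff_zero (right_ne_zero_of_mul h), abs_mul, abs_pow]
  simp

end TrailingCoeff

lemma fkDet_nonneg {G : Type*} [Group G] {r s : ℕ} (f : L2Pow G r →L[ℂ] L2Pow G s) :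
    0 ≤ fkDet f := by
  unfold fkDet
  positivity

section FiniteGroup

variable {G : Type u} {r s : ℕ}

/-- The standard basis of `L²(G)^r` for a finite group `G`, as a finite orthonormal basis. -/
def stdOrthonormalBasis (G : Type u) [Fintype G] (r : ℕ) :
    OrthonormalBasis (Fin r × G) ℂ (L2Pow G r) :=
  (stdBasis G r).toOrthonormalBasis

instance finiteDimensional_L2Pow [Finite G] : FiniteDimensional ℂ (L2Pow G r) :=
  have := Fintype.ofFinite G
  (stdOrthonormalBasis G r).toBasis.finiteDimensional_of_finite

variable [Fintype G]

lemma stdOrthonormalBasis_apply (p : Fin r × G) : stdOrthonormalBasis G r p = stdBasis G r p :=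
  congrFun (HilbertBasis.coe_toOrthonormalBasis _) p

variable [Group G]

lemma IsEquivariant.card_mul_spectralDensity {f : L2Pow G r →L[ℂ] L2Pow G s}
    (hf : IsEquivariant f) {t : ℝ} (ht : 0 ≤ t) :
    Fintype.card G * spectralDensity f t =
      ∑ p, ‖(spectralSubspace (f.adjoint ∘L f) (t ^ 2)).starProjection
        (stdOrthonormalBasis G r p)‖ ^ 2 := by
  simp_rw [stdOrthonormalBasis_apply, hf.norm_starProjection_stdBasis]
  rw [Fintype.sum_prod_type, spectralDensity, if_pos ht, vnDim_eq, Finset.mul_sum]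
  simp

lemma IsEquivariant.fkDet_pow_card_sq {f : L2Pow G r →L[ℂ] L2Pow G s} (hf : IsEquivariant f) :
    (fkDet f ^ Fintype.card G) ^ 2 =
      ‖(f.adjoint ∘L f).toLinearMap.charpoly.trailingCoeff‖ := by
  have hpos := ContinuousLinearMap.isPositive_adjoint_comp_self f
  have hS := hpos.isSelfAdjoint
  have hnonneg := hpos.toLinearMap.nonneg_eigenvalues rfl
  rw [hS.isSymmetric.charpoly_eq rfl, fkDet_pow_eq_prod Fintype.card_ne_zero fun t ht => by
    rw [hf.card_mul_spectralDensity ht, sum_norm_sq_starProjection_spectralSubspace _ hS],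
    ← Finset.prod_pow]
  refine Eq.trans ?_ (norm_trailingCoeff_prod_X_sub_C hnonneg).symm
  refine Finset.prod_congr rfl fun i _ => ?_
  split_ifs
  · exact Real.sq_sqrt (hnonneg i)
  · exact one_pow 2

variable [DecidableEq G]

lemma toMatrix_rightMulMatrix (A : Matrix (Fin r) (Fin s) (MonoidAlgebra ℤ G)) :
    LinearMap.toMatrix (stdOrthonormalBasis G r).toBasis (stdOrthonormalBasis G s).toBasis
      (rightMulMatrix A).toLinearMap = (rightMulCoeff A).map (Int.castRingHom ℂ) := by
  ext p q
  rw [LinearMap.toMatrix_apply, OrthonormalBasis.coe_toBasis_repr_apply,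
    OrthonormalBasis.repr_apply_apply, OrthonormalBasis.coe_toBasis, stdOrthonormalBasis_apply,
    stdOrthonormalBasis_apply]
  exact inner_rightMulMatrix A p q

lemma fkDet_pow_card_sq (A : Matrix (Fin r) (Fin s) (MonoidAlgebra ℤ G)) :
    (fkDet (rightMulMatrix A) ^ Fintype.card G) ^ 2 =
      |(((rightMulCoeff A).transpose * rightMulCoeff A).charpoly.trailingCoeff : ℝ)| := by
  have hmat : LinearMap.toMatrix (stdOrthonormalBasis G r).toBasis
      (stdOrthonormalBasis G r).toBasis ((rightMulMatrix A).adjoint ∘L rightMulMatrix A).toLinearMap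
      = ((rightMulCoeff A).transpose * rightMulCoeff A).map (Int.castRingHom ℂ) := by
    rw [ContinuousLinearMap.toLinearMap_comp,
      LinearMap.toMatrix_comp _ (stdOrthonormalBasis G s).toBasis,
      ← ContinuousLinearMap.adjoint_toLinearMap, LinearMap.toMatrix_adjoint,
      toMatrix_rightMulMatrix, Matrix.map_mul]
    congr 1
    ext p q
    simp
  rw [(isEquivariant_rightMulMatrix A).fkDet_pow_card_sq, ← LinearMap.charpoly_toMatrix _
    (stdOrthonormalBasis G r).toBasis, hmat, Matrix.charpoly_map,
    trailingCoeff_map_of_injective (RingHom.injective_int _)]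
  exact Complex.norm_intCast _

lemma isWeakIso_iff_det_ne_zero (A : Matrix (Fin r) (Fin r) (MonoidAlgebra ℤ G)) :
    IsWeakIso (rightMulMatrix A) ↔ (rightMulCoeff A).det ≠ 0 := by
  set f := (rightMulMatrix A).toLinearMap with hf
  have hinj : IsWeakIso (rightMulMatrix A) ↔ Function.Injective f :=
    ⟨And.left, fun h => ⟨h, (LinearMap.injective_iff_surjective.1 h).denseRange⟩⟩
  have hdet : f.det = (rightMulCoeff A).det := by
    rw [← LinearMap.det_toMatrix (stdOrthonormalBasis G r).toBasis, hf, toMatrix_rightMulMatrix,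
      ← RingHom.mapMatrix_apply, ← RingHom.map_det, eq_intCast]
  rw [hinj, ← LinearMap.ker_eq_bot, ← not_iff_not, ← ne_eq, ← LinearMap.det_eq_zero_iff_ker_ne_bot,
    hdet, not_not, Int.cast_eq_zero]

lemma fkDet_pow_card (A : Matrix (Fin r) (Fin r) (MonoidAlgebra ℤ G))
    (hA : IsWeakIso (rightMulMatrix A)) :
    fkDet (rightMulMatrix A) ^ Fintype.card G = |((rightMulCoeff A).det : ℝ)| := by
  have hdet := (isWeakIso_iff_det_ne_zero A).1 hA
  rw [← abs_of_nonneg (pow_nonneg (fkDet_nonneg _) _), ← sq_eq_sq_iff_abs_eq_abs,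
    fkDet_pow_card_sq, ← Int.cast_abs, abs_trailingCoeff_charpoly (by simpa using hdet)]
  simp [sq]

end FiniteGroup

/-! ### Scalar rows and the element `∑_{g ≠ 1} g` -/

section ScalarRow

variable {G : Type u} [Group G] {r s : ℕ}

lemma fkDet_of_adjoint_comp_self {f : L2Pow G r →L[ℂ] L2Pow G s} {c : ℝ}
    (h : f.adjoint ∘L f = (c : ℂ) • ContinuousLinearMap.id ℂ (L2Pow G r)) :
    fkDet f = (if 0 < c then √c else 1) ^ r := by
  have hS := (ContinuousLinearMap.isPositive_adjoint_comp_self f).isSelfAdjoint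
  have hdens : ∀ t, 0 ≤ t →
      (1 : ℕ) * spectralDensity f t = ∑ _ : Fin r, if c ≤ t ^ 2 then 1 else 0 := by
    intro t ht
    rw [Nat.cast_one, one_mul, spectralDensity, if_pos ht, vnDim_eq]
    refine Finset.sum_congr rfl fun i _ => ?_
    rw [starProjection_spectralSubspace_eigenvector hS (l := c) (by rw [h]; rfl),
      unitVec_eq_stdBasis]
    split_ifs <;> simp [(stdBasis G r).orthonormal.1]
  rw [← pow_one (fkDet f), fkDet_pow_eq_prod one_ne_zero hdens, Finset.prod_const,
    Finset.card_univ, Fintype.card_fin]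

/-- The one-row matrix over `ℤG` whose entries are the integers `n j`. -/
def scalarRow (G : Type u) [Group G] (n : Fin s → ℤ) :
    Matrix (Fin 1) (Fin s) (MonoidAlgebra ℤ G) :=
  .of fun _ j => .single 1 (n j)

lemma rightMulMatrix_scalarRow_apply (n : Fin s → ℤ) (x : L2Pow G 1) (j : Fin s) :
    rightMulMatrix (scalarRow G n) x j = (n j : ℂ) • x 0 := by
  have h1 : rightTranslate (1 : G) (x 0) = x 0 := by
    ext g
    exact congrArg (x 0) (by simp)
  have h : rightMulMatrix (scalarRow G n) x j = rightMul (.single (1 : G) (n j)) (x 0) := by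
    simp [rightMulMatrix, scalarRow]
  rw [h, rightMul, MonoidAlgebra.coeff_single, Finsupp.sum_single_index (by simp)]
  exact congrArg ((n j : ℂ) • ·) h1

lemma adjoint_comp_rightMulMatrix_scalarRow (n : Fin s → ℤ) :
    (rightMulMatrix (scalarRow G n)).adjoint ∘L rightMulMatrix (scalarRow G n) =
      ((∑ j, (n j : ℝ) ^ 2 : ℝ) : ℂ) • ContinuousLinearMap.id ℂ (L2Pow G 1) := by
  refine ContinuousLinearMap.ext fun x => ext_inner_left ℂ fun y => ?_
  simp [ContinuousLinearMap.adjoint_inner_right, PiLp.inner_apply, rightMulMatrix_scalarRow_apply,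
    inner_smul_left, inner_smul_right, Finset.sum_mul, sq, mul_assoc]

lemma fkDet_scalarRow (n : Fin s → ℤ) : fkDet (rightMulMatrix (scalarRow G n)) =
    if (0 : ℝ) < ∑ j, (n j : ℝ) ^ 2 then √(∑ j, (n j : ℝ) ^ 2) else 1 := by
  rw [fkDet_of_adjoint_comp_self (adjoint_comp_rightMulMatrix_scalarRow n), pow_one]

lemma isWeakIso_scalarRow {n : ℤ} (hn : n ≠ 0) :
    IsWeakIso (rightMulMatrix (scalarRow G ![n])) := by
  have hn' : (n : ℂ) ≠ 0 := Int.cast_ne_zero.2 hn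
  have h : ⇑(rightMulMatrix (scalarRow G ![n])) = fun x => (n : ℂ) • x := by
    ext x i : 2
    rw [Subsingleton.elim i 0, rightMulMatrix_scalarRow_apply]
    rfl
  rw [IsWeakIso, h]
  exact ⟨smul_right_injective _ hn', (MulAction.surjective₀ hn').denseRange⟩

lemma eq_scalarRow [Subsingleton G] (A : Matrix (Fin 1) (Fin s) (MonoidAlgebra ℤ G)) :
    A = scalarRow G fun j => (A 0 j).coeff 1 := by
  ext i j g
  simp [scalarRow, Subsingleton.elim i 0, Subsingleton.elim g 1]

end ScalarRow

section NormSubOne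

variable (G : Type u) [Group G] [Fintype G] [DecidableEq G]

/-- The element `∑_{g ≠ 1} g = N - 1` of `ℤG` for a finite group `G` with norm element `N`, as a
`(1,1)`-matrix. -/
def normSubOne : Matrix (Fin 1) (Fin 1) (MonoidAlgebra ℤ G) :=
  .of fun _ _ => .ofCoeff (Finsupp.equivFunOnFinite.symm fun g => if g = 1 then 0 else 1)

lemma abs_det_rightMulCoeff_normSubOne :
    |(rightMulCoeff (normSubOne G)).det| = |(Fintype.card G : ℤ) - 1| := by
  have h : rightMulCoeff (normSubOne G) = -(1 +
      Matrix.replicateCol Unit (fun _ : Fin 1 × G => (-1 : ℤ)) *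
        Matrix.replicateRow Unit fun _ : Fin 1 × G => (1 : ℤ)) := by
    ext p q
    have h1 : q.2⁻¹ * p.2 = 1 ↔ p = q := by
      rw [inv_mul_eq_one, Prod.ext_iff, eq_comm (a := q.2), and_iff_right (Subsingleton.elim _ _)]
    simp only [rightMulCoeff, normSubOne, Matrix.of_apply,
      Finsupp.equivFunOnFinite_symm_apply_apply, h1, Matrix.neg_apply, Matrix.add_apply,
      Matrix.one_apply, Matrix.mul_apply]
    by_cases hpq : p = q <;> simp [hpq]
  rw [h, Matrix.det_neg, Matrix.det_one_add_replicateCol_mul_replicateRow, abs_mul, abs_pow]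
  simp [dotProduct, ← sub_eq_add_neg, abs_sub_comm]

end NormSubOne

/-! ### The group of order two -/

lemma det_fromBlocks_circulant {m R : Type*} [Fintype m] [DecidableEq m] [CommRing R]
    (M N : Matrix m m R) : (Matrix.fromBlocks M N N M).det = (M + N).det * (M - N).det := by
  have h : Matrix.fromBlocks 1 1 0 1 * Matrix.fromBlocks M N N M * Matrix.fromBlocks 1 (-1) 0 1 =
      Matrix.fromBlocks (M + N) 0 N (M - N) := by
    simp only [Matrix.fromBlocks_multiply, one_mul, zero_mul, zero_add, mul_one, mul_zero,
      add_zero, mul_neg, Matrix.fromBlocks_inj, true_and]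
    constructor <;> abel
  simpa [Matrix.det_mul, Matrix.det_fromBlocks_zero₁₂, Matrix.det_fromBlocks_zero₂₁]
    using congrArg Matrix.det h

lemma even_det_add_iff_even_det_sub {m : Type*} [Fintype m] [DecidableEq m]
    (M N : Matrix m m ℤ) : Even (M + N).det ↔ Even (M - N).det := by
  have hmod : (M + N).map (Int.castRingHom (ZMod 2)) = (M - N).map (Int.castRingHom (ZMod 2)) := by
    ext i j
    simp [CharTwo.sub_eq_add]
  have hdet := congrArg Matrix.det hmod
  rw [← RingHom.mapMatrix_apply, ← RingHom.mapMatrix_apply, ← RingHom.map_det, ← RingHom.map_det,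
    eq_intCast, eq_intCast] at hdet
  rw [← ZMod.intCast_eq_zero_iff_even, ← ZMod.intCast_eq_zero_iff_even, hdet]

lemma three_le_abs_mul_of_parity {a b : ℤ} (h : Even a ↔ Even b) (h1 : 1 < |a * b|) :
    3 ≤ |a * b| := by
  by_contra! h3
  have h2 : |a * b| = 2 := by omega
  have heven : Even a ∨ Even b := Int.even_mul.1 (even_abs.1 (h2 ▸ even_two))
  obtain ⟨x, rfl⟩ : Even a := by tauto
  obtain ⟨y, rfl⟩ : Even b := by tauto
  have h4 : (4 : ℤ) ∣ |(x + x) * (y + y)| := (dvd_abs _ _).2 ⟨x * y, by ring⟩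
  omega

lemma trailingCoeff_X_sq_sub {R : Type*} [CommRing R] [IsDomain R] {a : R} (ha : a ≠ 0) :
    (Polynomial.X ^ 2 - Polynomial.C a * Polynomial.X).trailingCoeff = -a := by
  have h : (Polynomial.X ^ 2 - Polynomial.C a * Polynomial.X) =
      (Polynomial.X - Polynomial.C a) * Polynomial.X := by ring
  rw [h, Polynomial.trailingCoeff_mul, Polynomial.trailingCoeff_eq_coeff_zero (by simpa using ha)]
  simp [Polynomial.trailingCoeff]

section OrderTwo

variable {C : Type u} [Group C]

lemma exists_fintype_forall_ne_one_iff (hC : Nat.card C = 2) :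
    ∃ (_ : Fintype C) (τ : C), ∀ g, g ≠ 1 ↔ g = τ := by
  have : Finite C := Nat.finite_of_card_ne_zero (by omega)
  obtain ⟨τ, hτ, huniq⟩ := (Nat.card_eq_two_iff' (1 : C)).1 hC
  exact ⟨.ofFinite C, τ, fun g => ⟨huniq g, fun h => h ▸ hτ⟩⟩

variable {τ : C} (hτ : ∀ g, g ≠ 1 ↔ g = τ)
include hτ

lemma mul_self_of_forall_ne_one_iff : τ * τ = 1 :=
  mul_eq_one_iff_eq_inv.2 ((hτ _).1 (inv_ne_one.2 ((hτ τ).2 rfl))).symm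

lemma bijective_elim_of_forall_ne_one_iff (r : ℕ) : Function.Bijective
    (Sum.elim (·, 1) (·, τ) : Fin r ⊕ Fin r → Fin r × C) := by
  have hne : τ ≠ 1 := (hτ τ).2 rfl
  refine ⟨?_, fun ⟨i, g⟩ => ?_⟩
  · rintro (i | i) (j | j) <;> simp [hne, hne.symm]
  · by_cases hg : g = 1
    · exact ⟨.inl i, by simp [hg]⟩
    · exact ⟨.inr i, by simp [(hτ g).1 hg]⟩

variable [Fintype C]

lemma card_eq_two_of_forall_ne_one_iff : Fintype.card C = 2 := by
  have h := Fintype.card_of_bijective (bijective_elim_of_forall_ne_one_iff hτ 1)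
  simpa using h.symm

lemma trace_transpose_mul_rightMulCoeff_of_forall_ne_one_iff
    (A : Matrix (Fin 1) (Fin 1) (MonoidAlgebra ℤ C)) :
    ((rightMulCoeff A).transpose * rightMulCoeff A).trace =
      2 * ((A 0 0).coeff 1 ^ 2 + (A 0 0).coeff τ ^ 2) := by
  have hmul := mul_self_of_forall_ne_one_iff hτ
  have hinv := inv_eq_of_mul_eq_one_left hmul
  have hsum : ∀ F : Fin 1 × C → ℤ, ∑ p, F p = F (0, 1) + F (0, τ) := fun F => by
    rw [← (bijective_elim_of_forall_ne_one_iff hτ 1).sum_comp]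
    simp
  simp only [Matrix.trace, Matrix.diag_apply, Matrix.mul_apply, Matrix.transpose_apply, hsum,
    rightMulCoeff, Matrix.of_apply, hinv, hmul, inv_one, mul_one, one_mul]
  ring

variable [DecidableEq C]

lemma det_rightMulCoeff_of_forall_ne_one_iff {r : ℕ}
    (A : Matrix (Fin r) (Fin r) (MonoidAlgebra ℤ C)) :
    (rightMulCoeff A).det =
      (A.map (fun a => a.coeff 1) + A.map fun a => a.coeff τ).det *
      (A.map (fun a => a.coeff 1) - A.map fun a => a.coeff τ).det := by
  have hmul := mul_self_of_forall_ne_one_iff hτ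
  have hinv := inv_eq_of_mul_eq_one_left hmul
  rw [← det_fromBlocks_circulant, ← Matrix.det_transpose, ← Matrix.det_submatrix_equiv_self
    (Equiv.ofBijective _ (bijective_elim_of_forall_ne_one_iff hτ r))]
  congr 1
  ext p q
  rcases p with i | i <;> rcases q with j | j <;> simp [rightMulCoeff, hinv, hmul]

lemma det_rightMulCoeff_one_of_forall_ne_one_iff
    (A : Matrix (Fin 1) (Fin 1) (MonoidAlgebra ℤ C)) :
    (rightMulCoeff A).det = (A 0 0).coeff 1 ^ 2 - (A 0 0).coeff τ ^ 2 := by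
  rw [det_rightMulCoeff_of_forall_ne_one_iff hτ, Matrix.det_fin_one, Matrix.det_fin_one]
  simp only [Matrix.add_apply, Matrix.sub_apply, Matrix.map_apply]
  ring

lemma fkDet_sq_of_forall_ne_one_iff {r : ℕ} {A : Matrix (Fin r) (Fin r) (MonoidAlgebra ℤ C)}
    (hA : (rightMulCoeff A).det ≠ 0) :
    fkDet (rightMulMatrix A) ^ 2 = |((rightMulCoeff A).det : ℝ)| := by
  have h := fkDet_pow_card A ((isWeakIso_iff_det_ne_zero A).2 hA)
  rwa [card_eq_two_of_forall_ne_one_iff hτ] at h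

lemma fkDet_pow_four_of_det_eq_zero {A : Matrix (Fin 1) (Fin 1) (MonoidAlgebra ℤ C)}
    (hA : (rightMulCoeff A).det = 0) : fkDet (rightMulMatrix A) ^ 4 =
      if (A 0 0).coeff 1 = 0 then 1 else 4 * ((A 0 0).coeff 1 : ℝ) ^ 2 := by
  have hcard := card_eq_two_of_forall_ne_one_iff hτ
  have htrace : ((rightMulCoeff A).transpose * rightMulCoeff A).trace =
      4 * (A 0 0).coeff 1 ^ 2 := by
    rw [trace_transpose_mul_rightMulCoeff_of_forall_ne_one_iff hτ]
    rw [det_rightMulCoeff_one_of_forall_ne_one_iff hτ] at hA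
    linarith
  have hpow := fkDet_pow_card_sq A
  rw [hcard, ← pow_mul, Matrix.charpoly_of_card_eq_two _ (by simp [hcard]), Matrix.det_mul, hA,
    mul_zero, map_zero, add_zero, htrace] at hpow
  rw [hpow]
  split_ifs with h0
  · simp [h0, Polynomial.trailingCoeff]
  · rw [trailingCoeff_X_sq_sub (by positivity)]
    push_cast
    rw [abs_neg, abs_of_nonneg (by positivity)]

lemma det_rightMulCoeff_single_add_single (n : ℤ) :
    (rightMulCoeff (.of fun _ _ : Fin 1 => MonoidAlgebra.single (1 : C) n + .single τ 1)).det =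
      n ^ 2 - 1 := by
  have hne : τ ≠ 1 := (hτ τ).2 rfl
  rw [det_rightMulCoeff_one_of_forall_ne_one_iff hτ]
  simp [hne, hne.symm]

end OrderTwo

/-! ### Lehmer constants -/

section LehmerConst

/-- The common form of the four Lehmer constants: the infimum of the determinants `> 1` of
`(r, s)`-matrices over `ℤG` with `S r s`, where only weak isomorphisms are allowed if `w` holds. -/
def lehmerConst (S : ℕ → ℕ → Prop) (w : Prop) (G : Type u) [Group G] : ℝ :=
  sInf {d : ℝ | 1 < d ∧ ∃ (r s : ℕ) (A : Matrix (Fin r) (Fin s) (MonoidAlgebra ℤ G)),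
    S r s ∧ (w → IsWeakIso (rightMulMatrix A)) ∧ fkDet (rightMulMatrix A) = d}

variable {G : Type u} [Group G]

lemma lehmer_eq : lehmer G = lehmerConst (fun r s => 1 ≤ r ∧ 1 ≤ s) False G := by
  simp only [lehmer, lehmerConst, false_imp_iff, true_and, exists_and_left, and_assoc]

lemma lehmerOne_eq : lehmerOne G = lehmerConst (fun r s => r = 1 ∧ s = 1) False G := by
  simp [lehmerOne, lehmerConst, and_assoc]

lemma lehmerWeak_eq : lehmerWeak G = lehmerConst (fun r s => 1 ≤ r ∧ r = s) True G := by
  simp [lehmerWeak, lehmerConst, and_assoc]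

lemma lehmerWeakOne_eq : lehmerWeakOne G = lehmerConst (fun r s => r = 1 ∧ s = 1) True G := by
  simp [lehmerWeakOne, lehmerConst, and_assoc]

variable {S T : ℕ → ℕ → Prop} {v w : Prop}

lemma lehmerConst_le {r s : ℕ} (hS : S r s) {A : Matrix (Fin r) (Fin s) (MonoidAlgebra ℤ G)}
    (hw : w → IsWeakIso (rightMulMatrix A)) (h : 1 < fkDet (rightMulMatrix A)) :
    lehmerConst S w G ≤ fkDet (rightMulMatrix A) :=
  csInf_le ⟨1, fun _ hd => hd.1.le⟩ ⟨h, r, s, A, hS, hw, rfl⟩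

lemma fkDet_scalarRow_two : fkDet (rightMulMatrix (scalarRow G ![2])) = 2 := by
  simp [fkDet_scalarRow]

lemma le_lehmerConst (hS : S 1 1) {b : ℝ}
    (h : ∀ (r s : ℕ) (A : Matrix (Fin r) (Fin s) (MonoidAlgebra ℤ G)), S r s →
      (w → IsWeakIso (rightMulMatrix A)) → 1 < fkDet (rightMulMatrix A) →
        b ≤ fkDet (rightMulMatrix A)) : b ≤ lehmerConst S w G := by
  refine le_csInf ⟨2, one_lt_two, 1, 1, scalarRow G ![2], hS,
    fun _ => isWeakIso_scalarRow two_ne_zero, fkDet_scalarRow_two⟩ ?_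
  rintro _ ⟨hd, r, s, A, hrs, hw, rfl⟩
  exact h r s A hrs hw hd

lemma lehmerConst_le_two (hS : S 1 1) : lehmerConst S w G ≤ 2 := by
  refine (lehmerConst_le hS fun _ => isWeakIso_scalarRow two_ne_zero) ?_ |>.trans_eq
    fkDet_scalarRow_two
  rw [fkDet_scalarRow_two]
  exact one_lt_two

lemma lehmerConst_nonneg (hS : S 1 1) : 0 ≤ lehmerConst S w G :=
  le_lehmerConst hS fun _ _ _ _ _ _ => fkDet_nonneg _

lemma lehmerConst_anti (hT : T 1 1) (hTS : ∀ r s, T r s → S r s) (hvw : v → w) :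
    lehmerConst S v G ≤ lehmerConst T w G :=
  le_lehmerConst hT fun r s _ hrs hA h => lehmerConst_le (hTS r s hrs) (hA ∘ hvw) h

lemma lehmerConst_le_of_injective {H : Type u} [Group H] {φ : H →* G}
    (hφ : Function.Injective φ) (hS : S 1 1) : lehmerConst S w G ≤ lehmerConst S w H := by
  refine le_lehmerConst hS fun r s A hrs hA h => ?_
  rw [← fkDet_inducedMatrix hφ] at h ⊢
  exact lehmerConst_le hrs (fun hw => (isWeakIso_inducedMatrix_iff hφ A).2 (hA hw)) h

lemma isGLB_lehmerConst (hS : S 1 1) :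
    IsGLB {x : ℝ | ∃ H : Subgroup G, H.FG ∧ x = lehmerConst S w H} (lehmerConst S w G) := by
  refine ⟨?_, fun b hb => le_lehmerConst hS fun r s A hrs hA h => ?_⟩
  · rintro _ ⟨H, -, rfl⟩
    exact lehmerConst_le_of_injective H.subtype_injective hS
  · obtain ⟨H, hH, B, rfl⟩ := exists_fg_inducedMatrix A
    rw [fkDet_inducedMatrix H.subtype_injective] at h ⊢
    rw [isWeakIso_inducedMatrix_iff H.subtype_injective] at hA
    exact (hb ⟨H, hH, rfl⟩).trans (lehmerConst_le hrs hA h)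

lemma lehmerConst_rpow_inv_index_le (H : Subgroup G) [H.FiniteIndex] (hS : S 1 1)
    (hmul : ∀ n r s, 0 < n → S r s → S (r * n) (s * n)) :
    lehmerConst S w H ^ ((H.index : ℝ)⁻¹) ≤ lehmerConst S w G := by
  obtain ⟨t, ht⟩ := exists_transversal H
  have hn : H.index ≠ 0 := Subgroup.FiniteIndex.index_ne_zero
  refine le_lehmerConst hS fun r s A hrs hA h => ?_
  have hdet := fkDet_restrictedMatrix ht hn A
  rw [Real.rpow_inv_le_iff_of_pos (lehmerConst_nonneg hS) (fkDet_nonneg _) (by positivity),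
    Real.rpow_natCast, ← hdet]
  refine lehmerConst_le (hmul _ _ _ hn.bot_lt hrs)
    (fun hw => (isWeakIso_restrictedMatrix_iff ht A).1 (hA hw)) ?_
  rw [hdet]
  exact one_lt_pow₀ h hn

end LehmerConst

section Bounds

variable {G : Type u} [Group G]

lemma lehmer_le_lehmerOne : lehmer G ≤ lehmerOne G := by
  rw [lehmer_eq, lehmerOne_eq]
  exact lehmerConst_anti ⟨rfl, rfl⟩ (by omega) id

lemma lehmerWeak_le_lehmerWeakOne : lehmerWeak G ≤ lehmerWeakOne G := by
  rw [lehmerWeak_eq, lehmerWeakOne_eq]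
  exact lehmerConst_anti ⟨rfl, rfl⟩ (by omega) id

lemma lehmerOne_le_lehmerWeakOne : lehmerOne G ≤ lehmerWeakOne G := by
  rw [lehmerOne_eq, lehmerWeakOne_eq]
  exact lehmerConst_anti ⟨rfl, rfl⟩ (fun _ _ => id) False.elim

lemma lehmerWeakOne_le_two : lehmerWeakOne G ≤ 2 := by
  rw [lehmerWeakOne_eq]
  exact lehmerConst_le_two ⟨rfl, rfl⟩

lemma lehmer_le_sqrt_two : lehmer G ≤ √2 := by
  have h : fkDet (rightMulMatrix (scalarRow G ![1, 1])) = √2 := by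
    rw [fkDet_scalarRow]
    norm_num
  rw [lehmer_eq, ← h]
  refine lehmerConst_le ⟨le_rfl, one_le_two⟩ False.elim ?_
  rw [h]
  exact Real.one_lt_sqrt_two

end Bounds

lemma two_le_abs_of_one_lt {z : ℤ} (h : (1 : ℝ) < |(z : ℝ)|) : (2 : ℝ) ≤ |(z : ℝ)| := by
  rw [← Int.cast_abs] at h ⊢
  exact_mod_cast (show (2 : ℤ) ≤ |z| from by exact_mod_cast h)

section FiniteGroup

variable (G : Type u) [Group G] [Finite G]

lemma two_rpow_inv_card_le_lehmerWeak : (2 : ℝ) ^ ((Nat.card G : ℝ)⁻¹) ≤ lehmerWeak G := by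
  classical
  have := Fintype.ofFinite G
  rw [lehmerWeak_eq]
  refine le_lehmerConst ⟨le_rfl, rfl⟩ fun r _ A ⟨_, hrs⟩ hA h => ?_
  subst hrs
  rw [Nat.card_eq_fintype_card, Real.rpow_inv_le_iff_of_pos zero_le_two (fkDet_nonneg _)
    (by positivity), Real.rpow_natCast]
  have h1 := one_lt_pow₀ h (Fintype.card_ne_zero (α := G))
  rw [fkDet_pow_card A (hA trivial)] at h1 ⊢
  exact two_le_abs_of_one_lt h1

lemma two_rpow_inv_two_mul_card_le_lehmer :
    (2 : ℝ) ^ ((2 * (Nat.card G : ℝ))⁻¹) ≤ lehmer G := by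
  classical
  have := Fintype.ofFinite G
  rw [lehmer_eq]
  refine le_lehmerConst ⟨le_rfl, le_rfl⟩ fun r s A _ _ h => ?_
  rw [Nat.card_eq_fintype_card, Real.rpow_inv_le_iff_of_pos zero_le_two (fkDet_nonneg _)
    (by positivity), mul_comm, ← Nat.cast_ofNat (n := 2), ← Nat.cast_mul, Real.rpow_natCast,
    pow_mul]
  have h1 := one_lt_pow₀ (one_lt_pow₀ h (Fintype.card_ne_zero (α := G))) two_ne_zero
  rw [fkDet_pow_card_sq] at h1 ⊢
  exact two_le_abs_of_one_lt h1

lemma lehmerWeakOne_le_rpow_inv_card (hG : 3 ≤ Nat.card G) :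
    lehmerWeakOne G ≤ ((Nat.card G : ℝ) - 1) ^ ((Nat.card G : ℝ)⁻¹) := by
  classical
  have := Fintype.ofFinite G
  rw [Nat.card_eq_fintype_card] at hG ⊢
  have hG' : (3 : ℝ) ≤ Fintype.card G := by exact_mod_cast hG
  have hdet := abs_det_rightMulCoeff_normSubOne G
  rw [abs_of_pos (show (0 : ℤ) < Fintype.card G - 1 by omega)] at hdet
  have hw : IsWeakIso (rightMulMatrix (normSubOne G)) := by
    rw [isWeakIso_iff_det_ne_zero, ← abs_pos, hdet]
    omega
  have hfk : fkDet (rightMulMatrix (normSubOne G)) =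
      ((Fintype.card G : ℝ) - 1) ^ ((Fintype.card G : ℝ)⁻¹) := by
    rw [← Real.pow_rpow_inv_natCast (fkDet_nonneg _) (Fintype.card_ne_zero (α := G)),
      fkDet_pow_card _ hw, ← Int.cast_abs, hdet]
    push_cast
    rfl
  rw [lehmerWeakOne_eq, ← hfk]
  refine lehmerConst_le ⟨rfl, rfl⟩ (fun _ => hw) ?_
  rw [hfk]
  exact Real.one_lt_rpow (by linarith) (by positivity)

end FiniteGroup

section TrivialGroup

variable (E : Type u) [Group E] [Subsingleton E]

lemma two_le_lehmerOne : 2 ≤ lehmerOne E := by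
  rw [lehmerOne_eq]
  refine le_lehmerConst ⟨rfl, rfl⟩ fun _ _ A ⟨hr, hs⟩ _ h => ?_
  subst hr hs
  rw [eq_scalarRow A, fkDet_scalarRow, Fin.sum_univ_one, Real.sqrt_sq_eq_abs] at h ⊢
  split_ifs at h ⊢ with hpos
  · exact two_le_abs_of_one_lt h
  · exact absurd h (lt_irrefl 1)

lemma two_le_lehmerWeak : 2 ≤ lehmerWeak E := by
  simpa using two_rpow_inv_card_le_lehmerWeak E

lemma sqrt_two_le_lehmer : √2 ≤ lehmer E := by
  simpa [Real.sqrt_eq_rpow] using two_rpow_inv_two_mul_card_le_lehmer E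

lemma lehmer_values_of_subsingleton :
    lehmerOne E = 2 ∧ lehmerWeak E = 2 ∧ lehmerWeakOne E = 2 ∧ lehmer E = √2 := by
  have hone := two_le_lehmerOne E
  have hweak := two_le_lehmerWeak E
  have hle := lehmerWeakOne_le_two (G := E)
  exact ⟨(lehmerOne_le_lehmerWeakOne.trans hle).antisymm hone,
    (lehmerWeak_le_lehmerWeakOne.trans hle).antisymm hweak,
    hle.antisymm (hweak.trans lehmerWeak_le_lehmerWeakOne),
    lehmer_le_sqrt_two.antisymm (sqrt_two_le_lehmer E)⟩

end TrivialGroup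

section OrderTwo

variable {C : Type u} [Group C] (hC : Nat.card C = 2)
include hC

lemma two_rpow_quarter_le_lehmer : (2 : ℝ) ^ (1 / 4 : ℝ) ≤ lehmer C := by
  have : Finite C := Nat.finite_of_card_ne_zero (by omega)
  convert two_rpow_inv_two_mul_card_le_lehmer C using 2
  norm_num [hC]

lemma sqrt_three_le_lehmerWeak : √3 ≤ lehmerWeak C := by
  classical
  obtain ⟨_, τ, hτ⟩ := exists_fintype_forall_ne_one_iff hC
  rw [lehmerWeak_eq]
  refine le_lehmerConst ⟨le_rfl, rfl⟩ fun r _ A ⟨_, hrs⟩ hA h => ?_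
  subst hrs
  have h1 := one_lt_pow₀ h two_ne_zero
  rw [Real.sqrt_le_left (fkDet_nonneg _)]
  rw [fkDet_sq_of_forall_ne_one_iff hτ ((isWeakIso_iff_det_ne_zero A).1 (hA trivial)),
    det_rightMulCoeff_of_forall_ne_one_iff hτ, ← Int.cast_abs] at h1 ⊢
  exact_mod_cast three_le_abs_mul_of_parity (even_det_add_iff_even_det_sub _ _)
    (by exact_mod_cast h1)

lemma lehmerWeakOne_le_sqrt_three : lehmerWeakOne C ≤ √3 := by
  classical
  obtain ⟨_, τ, hτ⟩ := exists_fintype_forall_ne_one_iff hC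
  let A : Matrix (Fin 1) (Fin 1) (MonoidAlgebra ℤ C) := .of fun _ _ => .single 1 2 + .single τ 1
  have hdet : (rightMulCoeff A).det = 3 := det_rightMulCoeff_single_add_single hτ 2
  have hne : (rightMulCoeff A).det ≠ 0 := by omega
  have h3 : fkDet (rightMulMatrix A) = √3 := by
    rw [eq_comm, Real.sqrt_eq_iff_eq_sq (by norm_num) (fkDet_nonneg _),
      fkDet_sq_of_forall_ne_one_iff hτ hne, hdet]
    norm_num
  rw [lehmerWeakOne_eq, ← h3]
  refine lehmerConst_le ⟨rfl, rfl⟩ (fun _ => (isWeakIso_iff_det_ne_zero A).2 hne) ?_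
  rw [h3, Real.lt_sqrt zero_le_one]
  norm_num

lemma sqrt_two_le_lehmerOne : √2 ≤ lehmerOne C := by
  classical
  obtain ⟨_, τ, hτ⟩ := exists_fintype_forall_ne_one_iff hC
  rw [lehmerOne_eq]
  refine le_lehmerConst ⟨rfl, rfl⟩ fun _ _ A ⟨hr, hs⟩ _ h => ?_
  subst hr hs
  rw [Real.sqrt_le_left (fkDet_nonneg _)]
  by_cases hdet : (rightMulCoeff A).det = 0
  · have h4 := fkDet_pow_four_of_det_eq_zero hτ hdet
    have h1 := one_lt_pow₀ h four_ne_zero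
    split_ifs at h4 with h0
    · exact absurd h4 h1.ne'
    · have hcoeff : (1 : ℝ) ≤ ((A 0 0).coeff 1 : ℝ) ^ 2 := by
        exact_mod_cast Int.one_le_abs (pow_ne_zero 2 h0) |>.trans_eq (abs_sq _)
      nlinarith [sq_nonneg (fkDet (rightMulMatrix A))]
  · have h1 := one_lt_pow₀ h two_ne_zero
    rw [fkDet_sq_of_forall_ne_one_iff hτ hdet] at h1 ⊢
    exact two_le_abs_of_one_lt h1

lemma lehmerOne_le_sqrt_two : lehmerOne C ≤ √2 := by
  classical
  obtain ⟨_, τ, hτ⟩ := exists_fintype_forall_ne_one_iff hC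
  let A : Matrix (Fin 1) (Fin 1) (MonoidAlgebra ℤ C) := .of fun _ _ => .single 1 1 + .single τ 1
  have hdet : (rightMulCoeff A).det = 0 := det_rightMulCoeff_single_add_single hτ 1
  have hA : (A 0 0).coeff 1 = 1 := by simp [A, (hτ τ).2 rfl]
  have h4 : fkDet (rightMulMatrix A) ^ 4 = √2 ^ 4 := by
    rw [fkDet_pow_four_of_det_eq_zero hτ hdet, hA, if_neg one_ne_zero, pow_mul √2 2 2,
      Real.sq_sqrt zero_le_two]
    norm_num
  have h2 : fkDet (rightMulMatrix A) = √2 :=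
    (pow_left_inj₀ (fkDet_nonneg _) (Real.sqrt_nonneg _) four_ne_zero).1 h4
  rw [lehmerOne_eq, ← h2]
  refine lehmerConst_le ⟨rfl, rfl⟩ False.elim ?_
  rw [h2]
  exact Real.one_lt_sqrt_two

lemma lehmer_values_of_card_eq_two :
    lehmerWeak C = √3 ∧ lehmerWeakOne C = √3 ∧ lehmerOne C = √2 := by
  have hle := sqrt_three_le_lehmerWeak hC
  have hge := lehmerWeakOne_le_sqrt_three hC
  exact ⟨(lehmerWeak_le_lehmerWeakOne.trans hge).antisymm hle,
    hge.antisymm (hle.trans lehmerWeak_le_lehmerWeakOne),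
    (lehmerOne_le_sqrt_two hC).antisymm (sqrt_two_le_lehmerOne hC)⟩

end OrderTwo

end Lehmer

end

theorem lemma5p1 :
    -- subgroups
    (∀ (G : Type u) [Group G] (H : Subgroup G),
      Lehmer.lehmer G ≤ Lehmer.lehmer H ∧
      Lehmer.lehmerOne G ≤ Lehmer.lehmerOne H ∧
      Lehmer.lehmerWeak G ≤ Lehmer.lehmerWeak H ∧
      Lehmer.lehmerWeakOne G ≤ Lehmer.lehmerWeakOne H) ∧
    -- subgroups of finite index
    (∀ (G : Type u) [Group G] (H : Subgroup G), H.FiniteIndex →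
      Lehmer.lehmer H ^ ((H.index : ℝ)⁻¹) ≤ Lehmer.lehmer G ∧
      Lehmer.lehmerWeak H ^ ((H.index : ℝ)⁻¹) ≤ Lehmer.lehmerWeak G) ∧
    -- the trivial group
    (∀ (E : Type u) [Group E], Subsingleton E →
      Lehmer.lehmerOne E = 2 ∧ Lehmer.lehmerWeak E = 2 ∧ Lehmer.lehmerWeakOne E = 2 ∧
      Lehmer.lehmer E = √2) ∧
    -- the group of order two
    (∀ (C : Type u) [Group C], Nonempty (C ≃* Multiplicative (ZMod 2)) →
      Lehmer.lehmerWeak C = √3 ∧ Lehmer.lehmerWeakOne C = √3 ∧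
      Lehmer.lehmerOne C = √2 ∧
      (2 : ℝ) ^ (1 / 4 : ℝ) ≤ Lehmer.lehmer C ∧ Lehmer.lehmer C ≤ √2) ∧
    -- finite groups of order at least three
    (∀ (G : Type u) [Group G], Finite G → 3 ≤ Nat.card G →
      ((2 : ℝ) ^ ((Nat.card G : ℝ)⁻¹) ≤ Lehmer.lehmerWeak G ∧
        Lehmer.lehmerWeak G ≤ Lehmer.lehmerWeakOne G ∧
        Lehmer.lehmerWeakOne G ≤ ((Nat.card G : ℝ) - 1) ^ ((Nat.card G : ℝ)⁻¹)) ∧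
      ((2 : ℝ) ^ ((2 * (Nat.card G : ℝ))⁻¹) ≤ Lehmer.lehmer G ∧
        Lehmer.lehmer G ≤ Lehmer.lehmerOne G ∧
        Lehmer.lehmerOne G ≤ ((Nat.card G : ℝ) - 1) ^ ((Nat.card G : ℝ)⁻¹))) ∧
    -- finitely generated subgroups
    (∀ (G : Type u) [Group G],
      IsGLB {x : ℝ | ∃ H : Subgroup G, H.FG ∧ x = Lehmer.lehmer H} (Lehmer.lehmer G) ∧
      IsGLB {x : ℝ | ∃ H : Subgroup G, H.FG ∧ x = Lehmer.lehmerOne H} (Lehmer.lehmerOne G) ∧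
      IsGLB {x : ℝ | ∃ H : Subgroup G, H.FG ∧ x = Lehmer.lehmerWeak H} (Lehmer.lehmerWeak G) ∧
      IsGLB {x : ℝ | ∃ H : Subgroup G, H.FG ∧ x = Lehmer.lehmerWeakOne H}
        (Lehmer.lehmerWeakOne G)) := by
  refine ⟨fun G _ H => ?_, fun G _ H _ => ?_, fun E _ _ => Lehmer.lehmer_values_of_subsingleton E,
    fun C _ ⟨e⟩ => ?_, fun G _ _ hG => ?_, fun G _ => ?_⟩
  · simp only [Lehmer.lehmer_eq, Lehmer.lehmerOne_eq, Lehmer.lehmerWeak_eq, Lehmer.lehmerWeakOne_eq]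
    have hH := H.subtype_injective
    refine ⟨?_, ?_, ?_, ?_⟩ <;> exact Lehmer.lehmerConst_le_of_injective hH (by simp)
  · simp only [Lehmer.lehmer_eq, Lehmer.lehmerWeak_eq]
    exact ⟨Lehmer.lehmerConst_rpow_inv_index_le H ⟨le_rfl, le_rfl⟩ fun n r s hn h =>
        ⟨Nat.mul_pos h.1 hn, Nat.mul_pos h.2 hn⟩,
      Lehmer.lehmerConst_rpow_inv_index_le H ⟨le_rfl, rfl⟩ fun n r s hn h =>
        ⟨Nat.mul_pos h.1 hn, congrArg (· * n) h.2⟩⟩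
  · have hC : Nat.card C = 2 := (Nat.card_congr e.toEquiv).trans (Nat.card_zmod 2)
    obtain ⟨hweak, hweakOne, hone⟩ := Lehmer.lehmer_values_of_card_eq_two hC
    exact ⟨hweak, hweakOne, hone, Lehmer.two_rpow_quarter_le_lehmer hC, Lehmer.lehmer_le_sqrt_two⟩
  · have hle := Lehmer.lehmerWeakOne_le_rpow_inv_card G hG
    exact ⟨⟨Lehmer.two_rpow_inv_card_le_lehmerWeak G, Lehmer.lehmerWeak_le_lehmerWeakOne, hle⟩,
      Lehmer.two_rpow_inv_two_mul_card_le_lehmer G, Lehmer.lehmer_le_lehmerOne,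
      Lehmer.lehmerOne_le_lehmerWeakOne.trans hle⟩
  · simp only [Lehmer.lehmer_eq, Lehmer.lehmerOne_eq, Lehmer.lehmerWeak_eq, Lehmer.lehmerWeakOne_eq]
    refine ⟨?_, ?_, ?_, ?_⟩ <;> exact Lehmer.isGLB_lehmerConst (by simp)
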